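/- Let $m\ge 0$ be an integer, $2<p\le\infty$, let $\Omega\subset\mathbb C$ be a connected open set, and let $f:\Omega\to\mathbb C^m$ be continuous. Put $\Omega^*=\Omega\setminus f^{-1}(0)$, and let $A=(a_{jk})$ be an $m\times m$ matrix of functions $a_{jk}\in L^p(\Omega^*)$ such that $$\frac{\partial f}{\partial\bar z}=Af\quad\text{on }\Omega^*$$ in the sense of distributions. (The matrix of $(0,1)$-forms $A\,d\bar z$ is identified with the matrix $A$ of its coefficients, so that this is the equation $\bar\partial f=Af$.) Let $\tilde A$ be equal to $A$ on $\Omega^*$ and to $0$ on $f^{-1}(0)$. (1) If $f\not\equiv0$ on $\Omega$, then the zeros of $f$ in $\Omega$ are isolated, and $\partial f/\partial\bar z=\tilde Af$ holds on $\Omega$ in the sense of distributions. (2) Put $\phi_p(\delta)=\delta^{1-2/p}$ if $p<\infty$ and $\phi_\infty(\delta)=\delta(1+|\log\delta|)$. There are constants $\epsilon>0$ and $c>0$, depending only on $p$ and $m$, such that the following holds for all $\Omega,f,A$ as above (including $f\equiv0$) and all $M\in[0,\infty)$ with $\|a_{jk}\|_{L^p(\Omega^*)}\le M$ for all $j,k$.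 First, $\partial f/\partial\bar z=\tilde Af$ on $\Omega$ in the sense of distributions. Second, if $\delta>0$ and $M\phi_p(\delta)<\epsilon$, then for each $z\in\Omega$ there is an $m\times m$ matrix-valued function $g$ on the disc $D_\delta(z)=\{w\in\mathbb C:|w-z|<\delta\}$ such that - $I+g(w)$ is invertible for every $w\in D_\delta(z)$; - $(I+g)f$ is holomorphic on $D_\delta(z)\cap\Omega$; - $g\in C^\alpha(D_\delta(z))$, i.e. the entries of $g$ are Hölder continuous with exponent $\alpha$ on $D_\delta(z)$, with $\alpha=1-\frac2p$ if $p<\infty$, and for every $\alpha\in(0,1)$ if $p=\infty$; - $\sup_{w\in D_\delta(z)}|g_{jk}(w)|\le c\,M\,\phi_p(\delta)$ for all $j,k$. -/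

import Mathlib

open MeasureTheory Set Filter Topology
open scoped ENNReal NNReal ContDiff Matrix

noncomputable section

/-- The Wirtinger derivative `∂φ/∂z̄ = (∂φ/∂x + i ∂φ/∂y) / 2`. -/
def dzbar (φ : ℂ → ℂ) (z : ℂ) : ℂ :=
  (1 / 2) * (fderiv ℝ φ z 1 + Complex.I * fderiv ℝ φ z Complex.I)

/-- `∂u/∂z̄ = h` on the open set `U` in the sense of distributions, for locally integrable
`ℂ^m`-valued functions `u` and `h`, tested against complex-valued smooth functions with compact
support in `U`. -/
def DbarEqOn {m : ℕ} (u h : ℂ → Fin m → ℂ) (U : Set ℂ) : Prop :=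
  LocallyIntegrableOn u U ∧ LocallyIntegrableOn h U ∧
    ∀ φ : ℂ → ℂ, ContDiff ℝ ∞ φ → HasCompactSupport φ → tsupport φ ⊆ U →
      ∀ j : Fin m, ∫ z in U, u z j * dzbar φ z = -∫ z in U, h z j * φ z

/-- The part of `Ω` off the zero set of `f`. -/
def offZeros {m : ℕ} (Ω : Set ℂ) (f : ℂ → Fin m → ℂ) : Set ℂ :=
  {z ∈ Ω | f z ≠ 0}

/-- `φ_p(δ) = δ^(1 - 2/p)` for `p < ∞` and `φ_∞(δ) = δ (1 + |log δ|)`. -/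
def phi (p : ℝ≥0∞) (δ : ℝ) : ℝ :=
  if p = ⊤ then δ * (1 + |Real.log δ|) else δ ^ (1 - 2 / p.toReal)

/-- Every entry of `g` is Hölder continuous with exponent `α` on `U`. -/
def MatrixHolderOn {m : ℕ} (α : ℝ≥0) (g : ℂ → Matrix (Fin m) (Fin m) ℂ) (U : Set ℂ) : Prop :=
  ∀ j k, ∃ C : ℝ≥0, HolderOnWith C α (fun w => g w j k) U

end

/-! On a small disc the equation is gauged away. Let B be A on the part of the disc where f ≠ 0, and
0 elsewhere. If T is the Cauchy transform, a right inverse of ∂/∂z̄, a fixed point of g ↦ T(-(1 +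
g)B) satisfies ∂g/∂z̄ = -(1 + g)B. For p > 2 the kernel 1/(z - w) lies locally in the dual space
L^r, r < 2, so T maps L^p of a disc of radius δ to bounded functions with norm O(δ^(1 - 2/p)). When
Mδ^(1 - 2/p) is small the map is therefore a contraction, g is small and 1 + g is invertible
(`exists_gauge`). The same kernel estimates make g Hölder continuous.

The product rule (`weak_dzbar_mul_cauchyTransform`) now gives ∂((1 + g)f)/∂z̄ = 0 weakly where f ≠
0, and Weyl's lemma makes (1 + g)f holomorphic there. Nothing is assumed about the zero set of f; it
is crossed by Radó's theorem (`rado`), applied to each component, since a component can be nonzero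
only where f is.

Everything else follows from this local holomorphy. As 1 + g is invertible, f inherits the zero
alternative of holomorphic functions, so by connectedness its zeros are isolated unless f ≡ 0.
Isolated points are removable for the weak equation because f is continuous
(`weak_dzbar_of_finite_inter`). -/

/-! ### Radó's theorem. -/

open Complex ComplexConjugate Metric in
/-- Maximum principle off the zero set of `N`, for the difference of a holomorphic function and
a complex harmonic function `P + conj Q`. -/
lemma norm_sub_harmonic_le {c : ℂ} {R : ℝ} {N K P Q : ℂ → ℂ}
    (hN : ContinuousOn N (closedBall c R)) (hK : ContinuousOn K (closedBall c R))
    (hNd : DifferentiableOn ℂ N (ball c R ∩ {z | N z ≠ 0}))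
    (hKd : DifferentiableOn ℂ K (ball c R ∩ {z | N z ≠ 0}))
    (hP : Differentiable ℂ P) (hQ : Differentiable ℂ Q) {E : ℝ} (hE0 : 0 ≤ E)
    (hE : ∀ z ∈ sphere c R, ‖K z - P z - conj (Q z)‖ ≤ E) {a : ℂ} (ha : a ∈ ball c R)
    (haN : N a ≠ 0) : ‖K a - P a - conj (Q a)‖ ≤ E := by
  set w := K a - P a - conj (Q a) with hw
  rcases eq_or_ne w 0 with h0 | h0
  · simpa [h0] using hE0
  have hwn : (‖w‖ : ℂ) ≠ 0 := by simpa using h0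
  set t : ℂ := conj w / ‖w‖ with ht
  have htn : ‖t‖ = 1 := by
    rw [ht, norm_div, RCLike.norm_conj, norm_real, norm_norm, div_self (by simpa using h0)]
  have htw : t * w = ‖w‖ := by
    rw [ht, div_mul_eq_mul_div, mul_comm, mul_conj, normSq_eq_norm_sq]
    push_cast
    field_simp
  -- Since Re(t · conj Q) = Re(conj t · Q), replacing the antiholomorphic term by a holomorphic one
  -- leaves the real part unchanged. The rotation t makes Re L equal to ‖w‖ at a.
  set L : ℂ → ℂ := fun z => t * K z - t * P z - conj t * Q z with hL
  have hLre : ∀ z, (L z).re = (t * (K z - P z - conj (Q z))).re := by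
    intro z
    simp only [hL, sub_re, mul_re, conj_re, conj_im, sub_im]
    ring
  obtain ⟨C, hC⟩ := (isCompact_closedBall c R).exists_bound_of_continuousOn hN
  set U := ball c R ∩ {z | N z ≠ 0} with hU
  have hUsub : closure U ⊆ closedBall c R :=
    (closure_mono inter_subset_left).trans closure_ball_subset_closedBall
  have hUo : IsOpen U := (hN.mono ball_subset_closedBall).isOpen_inter_preimage isOpen_ball
    isOpen_compl_singleton
  -- The maximum principle applies to exp(n(L - E)) · N on {N ≠ 0}: at frontier points inside the
  -- disc the factor N vanishes, and on the circle Re L ≤ E. The bound C does not depend on n, so n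
  -- → ∞ excludes ‖w‖ > E.
  have hbound : ∀ n : ℕ, Real.exp (n * (‖w‖ - E)) * ‖N a‖ ≤ C := by
    intro n
    have hd : DiffContOnCl ℂ (fun z => exp (n * (L z - E)) * N z) U := by
      constructor
      · intro z hz
        exact ((((((hKd z hz).const_mul t).sub ((hP z).differentiableWithinAt.const_mul t)).sub
          ((hQ z).differentiableWithinAt.const_mul _)).sub_const _).const_mul _).cexp.mul (hNd z hz)
      · intro z hz
        have hKc := (hK z (hUsub hz)).mono hUsub
        have hNc := (hN z (hUsub hz)).mono hUsub
        have hPc := hP.continuous.continuousWithinAt (s := closure U) (x := z)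
        have hQc := hQ.continuous.continuousWithinAt (s := closure U) (x := z)
        exact ((((((hKc.const_mul t).sub (hPc.const_mul t)).sub (hQc.const_mul _)).sub
          continuousWithinAt_const).const_mul _).cexp).mul hNc
    have hnorm : ∀ z, ‖exp (n * (L z - E)) * N z‖ = Real.exp (n * ((L z).re - E)) * ‖N z‖ := by
      intro z
      rw [norm_mul, norm_exp]
      simp
    have key := norm_le_of_forall_mem_frontier_norm_le (isBounded_ball.subset inter_subset_left) hd
      (C := C) (z := a) ?_ (subset_closure ⟨ha, haN⟩)
    · rw [hnorm, hLre, ← hw, htw, ofReal_re] at key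
      exact key
    · intro z hz
      have hzc := hUsub hz.1
      rw [hnorm]
      have hC0 : 0 ≤ C := (norm_nonneg _).trans (hC z hzc)
      by_cases hNz : N z = 0
      · simpa [hNz] using hC0
      have hzs : z ∈ sphere c R := by
        rw [mem_sphere]
        refine le_antisymm hzc (not_lt.1 fun hlt => hz.2 ?_)
        rw [hUo.interior_eq]
        exact ⟨hlt, hNz⟩
      have hle : (L z).re ≤ E := by
        rw [hLre]
        refine (re_le_norm _).trans ?_
        rw [norm_mul, htn, one_mul]
        exact hE z hzs
      have : Real.exp (n * ((L z).re - E)) ≤ 1 := by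
        rw [Real.exp_le_one_iff]
        exact mul_nonpos_of_nonneg_of_nonpos n.cast_nonneg (by linarith)
      calc _ ≤ 1 * ‖N z‖ := by gcongr
        _ ≤ C := by rw [one_mul]; exact hC z hzc
  by_contra! hlt
  have hx : 0 < ‖w‖ - E := by linarith
  have hNp : 0 < ‖N a‖ := norm_pos_iff.2 haN
  obtain ⟨n, hn⟩ := exists_nat_gt (C / (‖N a‖ * (‖w‖ - E)))
  have h1 := hbound n
  have h2 := Real.add_one_le_exp (n * (‖w‖ - E))
  rw [div_lt_iff₀ (by positivity)] at hn
  nlinarith [mul_le_mul_of_nonneg_right h2 hNp.le]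

open Complex ComplexConjugate Metric in
/-- Continuous functions on a circle are uniform limits of complex harmonic polynomials. -/
lemma exists_harmonic_approx_on_sphere {c : ℂ} {R : ℝ} (hR : 0 < R) {F : ℂ → ℂ}
    (hF : ContinuousOn F (sphere c R)) {ε : ℝ} (hε : 0 < ε) :
    ∃ P Q : ℂ → ℂ, Differentiable ℂ P ∧ Differentiable ℂ Q ∧ Q c = 0 ∧
      ∀ z ∈ sphere c R, ‖F z - P z - conj (Q z)‖ ≤ ε := by
  have : Fact (0 < 2 * Real.pi) := ⟨Real.two_pi_pos⟩
  let S : Submodule ℂ C(AddCircle (2 * Real.pi), ℂ) :=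
    { carrier := {k | ∃ P Q : ℂ → ℂ, Differentiable ℂ P ∧ Differentiable ℂ Q ∧
        ∀ θ : ℝ, k θ = P (exp (θ * I)) + conj (Q (exp (θ * I)))}
      add_mem' := by
        rintro k l ⟨P, Q, hP, hQ, h⟩ ⟨P', Q', hP', hQ', h'⟩
        refine ⟨P + P', Q + Q', hP.add hP', hQ.add hQ', fun θ => ?_⟩
        simp only [ContinuousMap.add_apply, h, h', Pi.add_apply, map_add]
        ring
      zero_mem' := ⟨0, 0, by fun_prop, by fun_prop, by simp⟩
      smul_mem' := by
        rintro s k ⟨P, Q, hP, hQ, h⟩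
        refine ⟨fun z => s * P z, fun z => conj s * Q z, hP.const_mul s, hQ.const_mul _,
          fun θ => ?_⟩
        simp only [ContinuousMap.smul_apply, h, smul_eq_mul, map_mul, conj_conj]
        ring }
  -- On the unit circle the monomials e^(ikθ) and e^(-ikθ), k ≥ 0, are z^k and conj(z^k), so density
  -- of trigonometric polynomials is enough.
  have hS : Submodule.span ℂ (range <| @fourier (2 * Real.pi)) ≤ S := by
    rw [Submodule.span_le]
    rintro _ ⟨n, rfl⟩
    have hfour : ∀ θ : ℝ, (fourier n (θ : AddCircle (2 * Real.pi)) : ℂ) = exp (n * (θ * I)) := by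
      intro θ
      rw [fourier_coe_apply]
      congr 1
      have : (Real.pi : ℂ) ≠ 0 := by exact_mod_cast Real.pi_ne_zero
      push_cast
      field_simp
    obtain ⟨k, rfl | rfl⟩ := n.eq_nat_or_neg
    · refine ⟨fun z => z ^ k, 0, by fun_prop, by fun_prop, fun θ => ?_⟩
      rw [hfour]
      simp [← exp_nat_mul]
    · refine ⟨0, fun z => z ^ k, by fun_prop, by fun_prop, fun θ => ?_⟩
      rw [hfour]
      simp [← exp_nat_mul, ← exp_conj]
  have hper : Function.Periodic (fun θ : ℝ => F (circleMap c R θ)) (2 * Real.pi) := fun θ => by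
    simp only [periodic_circleMap c R θ]
  have hcont : Continuous (fun θ : ℝ => F (circleMap c R θ)) :=
    hF.comp_continuous (continuous_circleMap c R) (circleMap_mem_sphere c hR.le)
  let k : C(AddCircle (2 * Real.pi), ℂ) :=
    ⟨hper.lift, continuous_coinduced_dom.2 hcont⟩
  have hk : k ∈ (Submodule.span ℂ (range <| @fourier (2 * Real.pi))).topologicalClosure := by
    rw [span_fourier_closure_eq_top]; trivial
  obtain ⟨l, hl, hkl⟩ := Metric.mem_closure_iff.1 hk ε hε
  obtain ⟨P, Q, hP, hQ, h⟩ := hS hl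
  -- The constant term of Q is moved into P, which makes the splitting unique and Q small when the
  -- sum is.
  refine ⟨fun z => P ((z - c) / R) + conj (Q 0), fun z => Q ((z - c) / R) - Q 0,
    by fun_prop, by fun_prop, by simp, fun z hz => ?_⟩
  obtain ⟨θ, rfl⟩ : z ∈ range (circleMap c R) := by rwa [range_circleMap, abs_of_pos hR]
  have h1 : (circleMap c R θ - c) / R = exp (θ * I) := by
    have : (R : ℂ) ≠ 0 := by exact_mod_cast hR.ne'
    simp [circleMap, this]
  have h2 : k (θ : AddCircle (2 * Real.pi)) = F (circleMap c R θ) := rfl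
  have h3 := (ContinuousMap.dist_apply_le_dist (f := k) (g := l) (θ : AddCircle (2 * Real.pi)))
  rw [dist_eq_norm, h2, h] at h3
  simp only [h1]
  refine le_trans (le_of_eq ?_) (h3.trans hkl.le)
  congr 1
  rw [map_sub]
  ring

open Complex ComplexConjugate Metric in
/-- A harmonic function `P + conj Q` bounded by `E` has conjugate-analytic part of size `O(E)`. -/
lemma norm_le_of_norm_harmonic_le {c : ℂ} {R : ℝ} (hR : 0 < R) {P Q : ℂ → ℂ}
    (hP : Differentiable ℂ P) (hQ : Differentiable ℂ Q) (hQc : Q c = 0) {E : ℝ} (hE0 : 0 < E)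
    (hE : ∀ z ∈ ball c R, ‖P z + conj (Q z)‖ ≤ E) {z : ℂ} (hz : z ∈ ball c (R / 2)) :
    ‖Q z‖ ≤ 4 * E := by
  have hz' : ‖z - c‖ < R / 2 := by rwa [← dist_eq_norm]
  have hc : c ∈ ball c R := mem_ball_self hR
  have hcE := hE c hc
  have hmem : ∀ w ∈ ball (0 : ℂ) R, c + w ∈ ball c R := by
    intro w hw
    simpa [dist_eq_norm] using hw
  -- Borel–Carathéodory: for r = ‖z - c‖ < R/2 the factor 2r/(R - r) is below 2. It is used for P +
  -- Q and -i(P - Q), whose real parts are the real and imaginary parts of P + conj Q.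
  have aux : ∀ h : ℂ → ℂ, Differentiable ℂ h → (∀ w ∈ ball c R, (h w).re - (h c).re ≤ 2 * E) →
      ‖h z - h c‖ ≤ 4 * E := by
    intro h hh hb
    have := borelCaratheodory_zero (f := fun w => h (c + w) - h c) (M := 2 * E) (R := R)
      (z := z - c) (by positivity) (by fun_prop) (fun w hw => by simpa using hb _ (hmem w hw)) hR
      (by simpa using hz'.trans (by linarith)) (by simp)
    simp only [add_sub_cancel] at this
    refine this.trans ?_
    rw [div_le_iff₀ (by linarith)]
    nlinarith
  have hre : ∀ w, (P w + Q w).re = (P w + conj (Q w)).re := by intro w; simp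
  have him : ∀ w, (-I * (P w - Q w)).re = (P w + conj (Q w)).im := by
    intro w; simp; ring
  have h1 := aux (fun w => P w + Q w) (by fun_prop) fun w hw => by
    have := (abs_le.1 ((abs_re_le_norm _).trans (hE w hw))).2
    have := (abs_le.1 ((abs_re_le_norm _).trans hcE)).1
    rw [hre, hre]; linarith
  have h2 := aux (fun w => -I * (P w - Q w)) (by fun_prop) fun w hw => by
    have := (abs_le.1 ((abs_im_le_norm _).trans (hE w hw))).2
    have := (abs_le.1 ((abs_im_le_norm _).trans hcE)).1
    rw [him, him]; linarith
  have h3 : ‖-I * (P z - Q z) - -I * (P c - Q c)‖ = ‖(P z - Q z) - (P c - Q c)‖ := by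
    rw [← mul_sub, norm_mul]; simp
  rw [h3] at h2
  have h4 : 2 * Q z = (P z + Q z - (P c + Q c)) - ((P z - Q z) - (P c - Q c)) := by
    rw [hQc]; ring
  have h5 : 2 * ‖Q z‖ ≤ 4 * E + 4 * E := by
    calc 2 * ‖Q z‖ = ‖2 * Q z‖ := by simp
      _ ≤ _ := by rw [h4]; exact (norm_sub_le _ _).trans (add_le_add h1 h2)
  linarith

/-- A sequence of entire functions that is uniformly Cauchy on an open set converges there to a
holomorphic function. -/
lemma exists_differentiableOn_limit {U : Set ℂ} (hU : IsOpen U) {h : ℕ → ℂ → ℂ}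
    (hh : ∀ n, Differentiable ℂ (h n)) {e : ℕ → ℝ} (he : Tendsto e atTop (𝓝 0))
    (hb : ∀ n k, ∀ z ∈ U, ‖h n z - h k z‖ ≤ e n + e k) :
    ∃ H : ℂ → ℂ, DifferentiableOn ℂ H U ∧ ∀ z ∈ U, Tendsto (fun n => h n z) atTop (𝓝 (H z)) := by
  have huc : UniformCauchySeqOn h atTop U := by
    rw [Metric.uniformCauchySeqOn_iff]
    intro ε hε
    obtain ⟨N, hN⟩ := eventually_atTop.1 (he.eventually_lt_const (half_pos hε))
    refine ⟨N, fun n hn k hk z hz => ?_⟩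
    rw [dist_eq_norm]
    linarith [hb n k z hz, hN n hn, hN k hk]
  have hlim : ∀ z, ∃ y, z ∈ U → Tendsto (fun n => h n z) atTop (𝓝 y) := by
    intro z
    by_cases hz : z ∈ U
    · obtain ⟨y, hy⟩ := cauchySeq_tendsto_of_complete (huc.cauchySeq hz)
      exact ⟨y, fun _ => hy⟩
    · exact ⟨0, fun h => absurd h hz⟩
  choose H hH using hlim
  refine ⟨H, ?_, hH⟩
  have hunif := huc.tendstoUniformlyOn_of_tendsto hH
  exact hunif.tendstoLocallyUniformlyOn.differentiableOn
    (Eventually.of_forall fun n => (hh n).differentiableOn) hU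

open ComplexConjugate in
/-- A function that is both holomorphic and antiholomorphic has zero derivative. -/
lemma deriv_eq_zero_of_differentiableAt_conj {Q : ℂ → ℂ} {z : ℂ} (hQ : DifferentiableAt ℂ Q z)
    (hQ' : DifferentiableAt ℂ (fun w => conj (Q w)) z) : deriv Q z = 0 := by
  have h1 := Complex.conjCLE.hasFDerivAt.comp z (hQ.hasDerivAt.hasFDerivAt.restrictScalars ℝ)
  have h2 := hQ'.hasDerivAt.hasFDerivAt.restrictScalars ℝ
  have h3 := h1.unique h2
  have e1 := congrArg (fun T : ℂ →L[ℝ] ℂ => T 1) h3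
  have e2 := congrArg (fun T : ℂ →L[ℝ] ℂ => T Complex.I) h3
  simp at e1 e2
  rw [← e1] at e2
  have : Complex.I * conj (deriv Q z) = 0 := by linear_combination -(1 / 2) * e2
  simpa using this

/-- Punctured discs are connected. -/
lemma isPreconnected_ball_diff_center (b : ℂ) (r : ℝ) :
    IsPreconnected (Metric.ball b r \ {b}) := by
  have h : Metric.ball b r \ {b} =
      (fun q : ℝ × ℝ => b + q.1 * Complex.exp (q.2 * Complex.I)) '' (Ioo 0 r ×ˢ univ) := by
    ext z
    constructor
    · rintro ⟨hz, hzb⟩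
      refine ⟨(‖z - b‖, (z - b).arg), ⟨⟨?_, ?_⟩, trivial⟩, ?_⟩
      · exact norm_pos_iff.2 (sub_ne_zero.2 hzb)
      · rwa [← dist_eq_norm]
      · simp
    · rintro ⟨⟨s, θ⟩, ⟨⟨hs, hsr⟩, -⟩, rfl⟩
      dsimp at hs hsr
      constructor
      · simpa [dist_eq_norm, Complex.norm_exp_ofReal_mul_I, abs_of_pos hs] using hsr
      · simp [hs.ne']
  rw [h]
  exact (((convex_Ioo 0 r).prod convex_univ).isPreconnected).image _
    (by fun_prop)

/-- If a continuous function agrees off its zero set with a holomorphic function on a connected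
open set, and is not identically zero, then the two functions agree. -/
lemma eqOn_of_eqOn_ne_zero {D : Set ℂ} (hDo : IsOpen D) (hDc : IsPreconnected D) {u F : ℂ → ℂ}
    (hu : DifferentiableOn ℂ u D) (hF : ContinuousOn F D)
    (huF : ∀ z ∈ D, F z ≠ 0 → u z = F z) {a : ℂ} (ha : a ∈ D) (haF : F a ≠ 0) :
    EqOn F u D := by
  set W := D ∩ {z | F z ≠ 0} with hW
  have hWo : IsOpen W := hF.isOpen_inter_preimage hDo isOpen_compl_singleton
  have hana : AnalyticOnNhd ℂ u D := hu.analyticOnNhd hDo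
  have hcl : ∀ z ∈ D, z ∈ closure W → u z = F z := by
    intro z hz hzW
    have hd : ContinuousWithinAt (fun w => u w - F w) W z :=
      ((hu.continuousOn z hz).sub (hF z hz)).mono inter_subset_left
    have := hd.mem_closure_image hzW
    have himg : (fun w => u w - F w) '' W ⊆ {0} := by
      rintro _ ⟨w, hw, rfl⟩
      simp [huF w hw.1 hw.2]
    have := closure_mono himg this
    rw [closure_singleton] at this
    exact sub_eq_zero.1 this
  -- W is shown to be dense in D: the interior of its closure is relatively closed in D. At a limit
  -- point b with F b = 0, the function u cannot vanish near b, since then it would vanish on D, and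
  -- at a in particular.
  have hsub : D ⊆ interior (closure W) := by
    refine hDc.subset_of_closure_inter_subset isOpen_interior
      ⟨a, ha, interior_mono subset_closure (by rw [hWo.interior_eq]; exact ⟨ha, haF⟩)⟩ ?_
    rintro b ⟨hb, hbD⟩
    have hbW : b ∈ closure W := closure_minimal interior_subset isClosed_closure hb
    by_cases hFb : F b = 0
    swap
    · exact interior_mono subset_closure (by rw [hWo.interior_eq]; exact ⟨hbD, hFb⟩)
    rcases (hana b hbD).eventually_eq_zero_or_eventually_ne_zero with h0 | h0
    · have := hana.eqOn_zero_of_preconnected_of_eventuallyEq_zero hDc hbD h0 ha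
      exact absurd ((huF a ha haF).symm.trans this) haF
    rw [eventually_nhdsWithin_iff, Metric.eventually_nhds_iff_ball] at h0
    obtain ⟨r₁, hr₁, h0⟩ := h0
    obtain ⟨r₂, hr₂, hrD⟩ := Metric.isOpen_iff.1 hDo b hbD
    set r := min r₁ r₂
    have hr : 0 < r := lt_min hr₁ hr₂
    have hrD' : Metric.ball b r ⊆ D := (Metric.ball_subset_ball (min_le_right _ _)).trans hrD
    -- On the punctured disc u ≠ 0, so a point of the closure of W there has F = u ≠ 0 and lies in
    -- W. Hence W and the complement of its closure cover this connected set, and W meets it.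
    have hP : Metric.ball b r \ {b} ⊆ W := by
      refine (isPreconnected_ball_diff_center b r).subset_left_of_subset_union hWo
        isClosed_closure.isOpen_compl (disjoint_compl_right_iff_subset.2 subset_closure) ?_ ?_
      · rintro w ⟨hw, hwb⟩
        by_cases hwW : w ∈ closure W
        · refine Or.inl ⟨hrD' hw, fun hFw => ?_⟩
          exact h0 w (Metric.ball_subset_ball (min_le_left _ _) hw) hwb
            ((hcl w (hrD' hw) hwW).trans hFw)
        · exact Or.inr hwW
      · obtain ⟨w, hwW, hw⟩ := Metric.mem_closure_iff.1 hbW r hr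
        refine ⟨w, ⟨by rwa [Metric.mem_ball, dist_comm], ?_⟩, hwW⟩
        rintro rfl
        exact hwW.2 hFb
    rw [mem_interior_iff_mem_nhds]
    filter_upwards [Metric.ball_mem_nhds b hr] with w hw
    by_cases hwb : w = b
    · rwa [hwb]
    · exact subset_closure (hP ⟨hw, hwb⟩)
  exact fun z hz => (hcl z hz (interior_subset (hsub hz))).symm

-- Harmonic approximants P_n + conj Q_n of F on the circle also approximate F at the points of the
-- disc where F ≠ 0, by the maximum principle off the zero set. In the limit F = P + conj Q there.
-- As F is holomorphic there, Q' vanishes on an open set, nonempty because of `a`, hence throughout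
-- the half disc, and F agrees off its zeros with a holomorphic function.
open ComplexConjugate Metric in
lemma rado_on_ball {c : ℂ} {R : ℝ} (hR : 0 < R) {F : ℂ → ℂ}
    (hF : ContinuousOn F (closedBall c R))
    (hFd : DifferentiableOn ℂ F (ball c R ∩ {z | F z ≠ 0}))
    {a : ℂ} (ha : a ∈ ball c (R / 2)) (haF : F a ≠ 0) : DifferentiableOn ℂ F (ball c (R / 2)) := by
  have hhalf : ball c (R / 2) ⊆ ball c R := ball_subset_ball (by linarith)
  set e : ℕ → ℝ := fun n => 1 / (n + 1) with hedef
  have he0 : ∀ n, 0 < e n := fun n => by positivity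
  have he : Tendsto e atTop (𝓝 0) := tendsto_one_div_add_atTop_nhds_zero_nat
  choose P Q hP hQ hQc hPQ using fun n =>
    exists_harmonic_approx_on_sphere hR (hF.mono sphere_subset_closedBall) (he0 n)
  have hdiff : ∀ n k, ∀ z ∈ ball c R,
      ‖(P n z - P k z) + conj (Q n z - Q k z)‖ ≤ e n + e k := by
    intro n k z hz
    -- With N = 1 and K = 0 this is the ordinary maximum principle for a harmonic function on the
    -- whole disc.
    have := norm_sub_harmonic_le (N := fun _ => 1) (K := fun _ => 0) (P := fun z => P n z - P k z)
      (Q := fun z => Q n z - Q k z) (c := c) (R := R) (E := e n + e k) (a := z)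
      (by fun_prop) (by fun_prop) (by fun_prop) (by fun_prop) ((hP n).sub (hP k))
      ((hQ n).sub (hQ k)) (by linarith [he0 n, he0 k]) ?_ hz one_ne_zero
    · rw [← norm_neg, neg_add', ← zero_sub]
      exact this
    · intro w hw
      have : 0 - (P n w - P k w) - conj (Q n w - Q k w) =
          (F w - P n w - conj (Q n w)) - (F w - P k w - conj (Q k w)) := by
        rw [map_sub]; ring
      rw [this]
      exact (norm_sub_le _ _).trans (add_le_add (hPQ n w hw) (hPQ k w hw))
  have hQb : ∀ n k, ∀ z ∈ ball c (R / 2), ‖Q n z - Q k z‖ ≤ 4 * e n + 4 * e k := by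
    intro n k z hz
    rw [← mul_add]
    exact norm_le_of_norm_harmonic_le hR ((hP n).sub (hP k)) ((hQ n).sub (hQ k))
      (by simp [hQc]) (add_pos (he0 n) (he0 k)) (hdiff n k) hz
  have hPb : ∀ n k, ∀ z ∈ ball c (R / 2), ‖P n z - P k z‖ ≤ 5 * e n + 5 * e k := by
    intro n k z hz
    have h1 := hdiff n k z (hhalf hz)
    have h2 := hQb n k z hz
    have h3 : P n z - P k z =
      ((P n z - P k z) + conj (Q n z - Q k z)) - conj (Q n z - Q k z) := by ring
    rw [h3]
    refine (norm_sub_le _ _).trans ?_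
    rw [RCLike.norm_conj]
    linarith
  obtain ⟨Pl, hPl, hPt⟩ := exists_differentiableOn_limit isOpen_ball hP
    (by simpa using he.const_mul 5) hPb
  obtain ⟨Ql, hQl, hQt⟩ := exists_differentiableOn_limit isOpen_ball hQ
    (by simpa using he.const_mul 4) hQb
  have hFeq : ∀ z ∈ ball c (R / 2), F z ≠ 0 → F z = Pl z + conj (Ql z) := by
    intro z hz hFz
    have hle : ∀ n, ‖F z - P n z - conj (Q n z)‖ ≤ e n := fun n =>
      norm_sub_harmonic_le hF hF hFd hFd (hP n) (hQ n) (he0 n).le (hPQ n) (hhalf hz) hFz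
    have h1 := squeeze_zero_norm hle he
    have h2 : Tendsto (fun n => F z - P n z - conj (Q n z)) atTop
        (𝓝 (F z - Pl z - conj (Ql z))) :=
      (tendsto_const_nhds.sub (hPt z hz)).sub
        ((Complex.continuous_conj.tendsto _).comp (hQt z hz))
    have := tendsto_nhds_unique h1 h2
    linear_combination -this
  set W := ball c (R / 2) ∩ {z | F z ≠ 0} with hW
  have hWo : IsOpen W := (hF.mono (hhalf.trans ball_subset_closedBall)).isOpen_inter_preimage
    isOpen_ball isOpen_compl_singleton
  have hdQ : ∀ z ∈ W, deriv Ql z = 0 := by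
    intro z hz
    have hzb : ball c (R / 2) ∈ 𝓝 z := isOpen_ball.mem_nhds hz.1
    refine deriv_eq_zero_of_differentiableAt_conj (hQl.differentiableAt hzb) ?_
    have hFz : DifferentiableAt ℂ F z :=
      (hFd.mono (inter_subset_inter_left _ hhalf)).differentiableAt (hWo.mem_nhds hz)
    refine (hFz.sub (hPl.differentiableAt hzb)).congr_of_eventuallyEq ?_
    filter_upwards [hWo.mem_nhds hz] with w hw
    rw [Pi.sub_apply, hFeq w hw.1 hw.2]
    ring
  have hdQ0 : EqOn (deriv Ql) 0 (ball c (R / 2)) :=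
    ((hQl.analyticOnNhd isOpen_ball).deriv).eqOn_zero_of_preconnected_of_eventuallyEq_zero
      (convex_ball _ _).isPreconnected ha
      (by filter_upwards [hWo.mem_nhds ⟨ha, haF⟩] with w hw using hdQ w hw)
  obtain ⟨q, hq⟩ := isOpen_ball.exists_is_const_of_deriv_eq_zero
    (convex_ball c (R / 2)).isPreconnected hQl hdQ0
  have hu : DifferentiableOn ℂ (fun z => Pl z + conj q) (ball c (R / 2)) := hPl.add_const _
  refine hu.congr (eqOn_of_eqOn_ne_zero isOpen_ball (convex_ball _ _).isPreconnected hu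
    (hF.mono (hhalf.trans ball_subset_closedBall)) (fun z hz hFz => ?_) ha haF)
  rw [hFeq z hz hFz, hq z hz]

/-- **Radó's theorem**: a continuous function that is holomorphic off its zero set is
holomorphic. -/
theorem rado {U : Set ℂ} (hU : IsOpen U) {F : ℂ → ℂ} (hF : ContinuousOn F U)
    (hFd : DifferentiableOn ℂ F (U ∩ {z | F z ≠ 0})) : DifferentiableOn ℂ F U := by
  intro z hz
  refine DifferentiableAt.differentiableWithinAt ?_
  by_cases h : ∀ᶠ w in 𝓝 z, F w = 0
  · exact (differentiableAt_const 0).congr_of_eventuallyEq h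
  obtain ⟨R, hR, hRU⟩ := Metric.nhds_basis_closedBall.mem_iff.1 (hU.mem_nhds hz)
  rw [Metric.eventually_nhds_iff_ball] at h
  push Not at h
  obtain ⟨a, ha, haF⟩ := h (R / 2) (half_pos hR)
  exact (rado_on_ball hR (hF.mono hRU) (hFd.mono (inter_subset_inter_left _
    (Metric.ball_subset_closedBall.trans hRU))) ha haF).differentiableAt
    (Metric.ball_mem_nhds z (half_pos hR))

/-! ### Calculus of ∂/∂z̄ on test functions and convolutions. -/

lemma dzbar_mul {φ ψ : ℂ → ℂ} {z : ℂ} (hφ : DifferentiableAt ℝ φ z) (hψ : DifferentiableAt ℝ ψ z) :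
    dzbar (fun w => φ w * ψ w) z = dzbar φ z * ψ z + φ z * dzbar ψ z := by
  have : fderiv ℝ (fun w => φ w * ψ w) z = φ z • fderiv ℝ ψ z + ψ z • fderiv ℝ φ z :=
    fderiv_mul hφ hψ
  simp only [dzbar, this, add_apply, smul_apply,
    smul_eq_mul]
  ring

lemma continuous_dzbar {φ : ℂ → ℂ} (hφ : ContDiff ℝ ∞ φ) : Continuous (dzbar φ) := by
  have h := hφ.continuous_fderiv (by simp)
  exact continuous_const.mul ((h.clm_apply continuous_const).add
    (continuous_const.mul (h.clm_apply continuous_const)))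

lemma support_dzbar_subset (φ : ℂ → ℂ) : Function.support (dzbar φ) ⊆ tsupport φ := by
  intro z hz
  refine support_fderiv_subset ℝ fun h => hz ?_
  simp [dzbar, h]

lemma dzbar_eq_zero_of_notMem {φ : ℂ → ℂ} {z : ℂ} (hz : z ∉ tsupport φ) : dzbar φ z = 0 := by
  by_contra h
  exact hz (support_dzbar_subset φ h)

lemma hasCompactSupport_dzbar {φ : ℂ → ℂ} (hφ : HasCompactSupport φ) :
    HasCompactSupport (dzbar φ) :=
  hφ.of_isClosed_subset (isClosed_tsupport _)
    (closure_minimal (support_dzbar_subset φ) (isClosed_tsupport _))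

lemma dzbar_comp_const_sub {φ : ℂ → ℂ} (x t : ℂ) (hφ : Differentiable ℝ φ) :
    dzbar (fun s => φ (x - s)) t = -dzbar φ (x - t) := by
  have h : HasFDerivAt (fun s => φ (x - s)) (-fderiv ℝ φ (x - t)) t := by
    have h1 : HasFDerivAt (fun s : ℂ => x - s) (-ContinuousLinearMap.id ℝ ℂ) t :=
      (hasFDerivAt_id t).const_sub x
    have := (hφ (x - t)).hasFDerivAt.comp t h1
    convert! this using 1
    ext v; simp
  simp only [dzbar, h.fderiv, neg_apply]
  ring

/-- The convolution of a locally integrable kernel and a test function is smooth, and `∂/∂z̄` may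
be taken under the integral. -/
lemma contDiff_and_dzbar_convolution {k b : ℂ → ℂ} (hk : LocallyIntegrable k)
    (hb : ContDiff ℝ ∞ b) (hcb : HasCompactSupport b) :
    ContDiff ℝ ∞ (fun x => ∫ t, k t * b (x - t)) ∧
      ∀ x, dzbar (fun x => ∫ t, k t * b (x - t)) x = ∫ t, k t * dzbar b (x - t) := by
  refine ⟨hcb.contDiff_convolution_right (ContinuousLinearMap.mul ℝ ℂ) hk hb, fun x => ?_⟩
  have hfd := hcb.hasFDerivAt_convolution_right (ContinuousLinearMap.mul ℝ ℂ) hk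
    (hb.of_le (by simp)) x
  have hex : Integrable (fun t => (ContinuousLinearMap.mul ℝ ℂ).precompR ℂ (k t)
      (fderiv ℝ b (x - t))) :=
    (hcb.fderiv ℝ).convolutionExists_right _ hk (hb.continuous_fderiv (by simp)) x
  have happ : ∀ v : ℂ, fderiv ℝ (fun x => ∫ t, k t * b (x - t)) x v =
      ∫ t, k t * fderiv ℝ b (x - t) v := by
    intro v
    have : fderiv ℝ (fun x => ∫ t, k t * b (x - t)) x = _ := hfd.fderiv
    rw [this, convolution_def, ContinuousLinearMap.integral_apply hex]
    rfl
  have hint : ∀ v : ℂ, Integrable (fun t => k t * fderiv ℝ b (x - t) v) := fun v =>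
    (hcb.fderiv_apply ℝ v).convolutionExists_right (ContinuousLinearMap.mul ℝ ℂ) hk
      ((hb.continuous_fderiv (by simp)).clm_apply continuous_const) x
  rw [dzbar, happ, happ, ← integral_const_mul, ← integral_add (hint 1) ((hint _).const_mul _),
    ← integral_const_mul]
  congr 1
  ext t
  rw [dzbar]
  ring

/-! ### The Cauchy–Pompeiu formula and Weyl's lemma. -/

lemma locallyIntegrable_inv : LocallyIntegrable (fun w : ℂ => w⁻¹) := by
  refine locallyIntegrable_of_norm_le_rpow (C := 1) (α := 1) (by simp) (by simp) ?_
    (by fun_prop)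
  refine Eventually.of_forall fun w => ?_
  rw [norm_inv, Real.rpow_neg_one, one_mul]

/-- The Cauchy–Pompeiu formula for test functions. -/
lemma integral_inv_mul_dzbar {b : ℂ → ℂ} (hb : ContDiff ℝ ∞ b) (hcb : HasCompactSupport b) :
    ∫ w, w⁻¹ * dzbar b w = -Real.pi * b 0 := by
  obtain ⟨R, hR0, hR⟩ := hcb.isCompact.isBounded.exists_pos_norm_lt
  have hbR : ∀ w : ℂ, R ≤ ‖w‖ → fderiv ℝ b w = 0 := by
    intro w hw
    by_contra h
    exact absurd (hR w (support_fderiv_subset ℝ h)) (not_lt.2 hw)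
  have hbR0 : ∀ w : ℂ, R ≤ ‖w‖ → b w = 0 := by
    intro w hw
    by_contra h
    exact absurd (hR w (subset_tsupport _ h)) (not_lt.2 hw)
  set e : ℝ → ℂ := fun θ => Complex.exp (θ * Complex.I) with he
  have hec : Continuous e := by fun_prop
  have hen : ∀ θ, ‖e θ‖ = 1 := fun θ => Complex.norm_exp_ofReal_mul_I θ
  have hed : ∀ θ, HasDerivAt e (Complex.I * e θ) θ := by
    intro θ
    have h1 : HasDerivAt (fun θ : ℝ => (θ : ℂ) * Complex.I) Complex.I θ := by
      simpa using (Complex.ofRealCLM.hasDerivAt (x := θ)).mul_const Complex.I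
    simpa [he, mul_comm] using h1.cexp
  have hdb : Differentiable ℝ b := hb.differentiable (by simp)
  have hfc : Continuous (fderiv ℝ b) := hb.continuous_fderiv (by simp)
  -- radial and angular parts of the integrand
  set u : ℝ × ℝ → ℂ := fun q => fderiv ℝ b (q.1 * e q.2) (e q.2) with hu
  set v : ℝ × ℝ → ℂ := fun q => fderiv ℝ b (q.1 * e q.2) (Complex.I * e q.2) with hv
  have huc : Continuous u := by
    refine (hfc.comp (by fun_prop)).clm_apply (by fun_prop)
  have hvc : Continuous v := by
    refine (hfc.comp (by fun_prop)).clm_apply (by fun_prop)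
  have hint : ∀ h : ℝ × ℝ → ℂ, Continuous h → (∀ q : ℝ × ℝ, R ≤ q.1 → h q = 0) →
      IntegrableOn h (Ioi 0 ×ˢ Ioo (-Real.pi) Real.pi) := by
    intro h hc h0
    have h1 : IntegrableOn h (Icc 0 R ×ˢ Icc (-Real.pi) Real.pi) :=
      hc.continuousOn.integrableOn_compact (isCompact_Icc.prod isCompact_Icc)
    refine h1.of_forall_sdiff_eq_zero (measurableSet_Ioi.prod measurableSet_Ioo) ?_
    rintro ⟨r, θ⟩ ⟨⟨hr, hθ⟩, hn⟩
    refine h0 _ (not_lt.1 fun hlt => hn ⟨⟨le_of_lt hr, hlt.le⟩, Ioo_subset_Icc_self hθ⟩)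
  have hnorm : ∀ q : ℝ × ℝ, R ≤ q.1 → R ≤ ‖(q.1 : ℂ) * e q.2‖ := by
    intro q hq
    rw [norm_mul, hen, mul_one, Complex.norm_real, Real.norm_eq_abs]
    exact hq.trans (le_abs_self _)
  have hui := hint u huc fun q hq => by simp [hu, hbR _ (hnorm q hq)]
  have hvi := hint v hvc fun q hq => by simp [hv, hbR _ (hnorm q hq)]
  -- Along each ray u is the radial derivative of b, so the integral over r is -b(0).
  have hu_int : ∫ q in Ioi 0 ×ˢ Ioo (-Real.pi) Real.pi, u q = -(2 * Real.pi) * b 0 := by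
    rw [Measure.volume_eq_prod, ← setIntegral_prod_swap,
      setIntegral_prod _ (by rw [← Measure.volume_eq_prod]; exact hui.swap)]
    have hin : ∀ θ : ℝ, ∫ r in Ioi (0 : ℝ), u (Prod.swap (θ, r)) = -b 0 := by
      intro θ
      have hder : ∀ r : ℝ, HasDerivAt (fun r : ℝ => b (r * e θ)) (u (r, θ)) r := by
        intro r
        have h1 : HasDerivAt (fun r : ℝ => (r : ℂ) * e θ) (e θ) r := by
          simpa using (Complex.ofRealCLM.hasDerivAt (x := r)).mul_const (e θ)
        exact (hdb _).hasFDerivAt.comp_hasDerivAt r h1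
      have hc1 : ContDiff ℝ 1 (fun r : ℝ => b (r * e θ)) :=
        (hb.of_le (by simp)).comp (Complex.ofRealCLM.contDiff.mul contDiff_const)
      have hcs : HasCompactSupport (fun r : ℝ => b (r * e θ)) := by
        refine HasCompactSupport.intro (isCompact_Icc (a := -R) (b := R)) fun r hr => ?_
        refine hbR0 _ ?_
        rw [norm_mul, hen, mul_one, Complex.norm_real, Real.norm_eq_abs]
        by_contra! hlt
        exact hr (abs_le.1 hlt.le)
      have := hcs.integral_Ioi_deriv_eq hc1 0
      simp only [fun r => (hder r).deriv] at this
      simpa using this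
    simp only [hin]
    rw [setIntegral_const, Real.volume_real_Ioo_of_le (by linarith [Real.pi_pos])]
    simp only [Complex.real_smul]
    push_cast
    ring
  -- On each circle v is the angular derivative of b divided by r, and integrates to 0 by
  -- periodicity.
  have hv_int : ∫ q in Ioi 0 ×ˢ Ioo (-Real.pi) Real.pi, v q = 0 := by
    rw [Measure.volume_eq_prod, setIntegral_prod _ (by rw [← Measure.volume_eq_prod]; exact hvi)]
    refine setIntegral_eq_zero_of_forall_eq_zero fun r hr => ?_
    rw [← integral_Ioc_eq_integral_Ioo,
      ← intervalIntegral.integral_of_le (by linarith [Real.pi_pos])]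
    have hr0 : (r : ℂ) ≠ 0 := by exact_mod_cast (ne_of_gt hr)
    have hder : ∀ θ : ℝ, HasDerivAt (fun θ : ℝ => (r : ℂ)⁻¹ * b (r * e θ)) (v (r, θ)) θ := by
      intro θ
      have h1 := ((hdb _).hasFDerivAt.comp_hasDerivAt θ ((hed θ).const_mul (r : ℂ))).const_mul
        (r : ℂ)⁻¹
      convert! h1 using 1
      have h2 : (r : ℂ) * (Complex.I * e θ) = r • (Complex.I * e θ) := by simp
      rw [h2, map_smul, Complex.real_smul, inv_mul_cancel_left₀ hr0]
    rw [intervalIntegral.integral_eq_sub_of_hasDerivAt (fun θ _ => hder θ)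
      ((hvc.comp (by fun_prop)).intervalIntegrable _ _)]
    have : e Real.pi = e (-Real.pi) := by
      simp [he, Complex.exp_neg]
    rw [this, sub_self]
  -- The Jacobian r cancels the modulus of 1/w, and the remaining phase turns b_x + i b_y into the
  -- radial derivative plus i times the tangential one.
  have hpt : ∀ q ∈ polarCoord.target, q.1 • ((Complex.polarCoord.symm q)⁻¹ *
      dzbar b (Complex.polarCoord.symm q)) = (1 / 2) * (u q + Complex.I * v q) := by
    rintro ⟨r, θ⟩ hq
    have hr : 0 < r := hq.1
    have hr0 : (r : ℂ) ≠ 0 := by exact_mod_cast hr.ne'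
    have hsym : Complex.polarCoord.symm (r, θ) = r * e θ := by
      rw [Complex.polarCoord_symm_apply]
      simp [he, Complex.exp_mul_I]
    have hlin : ∀ w : ℂ, ∀ T : ℂ →L[ℝ] ℂ, T w = w.re * T 1 + w.im * T Complex.I := by
      intro w T
      conv_lhs => rw [show w = w.re • (1 : ℂ) + w.im • Complex.I by
        simp only [Complex.real_smul, mul_one, Complex.re_add_im]]
      rw [map_add, map_smul, map_smul, Complex.real_smul, Complex.real_smul]
    have he1 : (e θ)⁻¹ = (e θ).re - (e θ).im * Complex.I := by
      rw [Complex.inv_def, Complex.normSq_eq_norm_sq, hen]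
      apply Complex.ext <;> simp
    rw [hsym]
    simp only [hu, hv, dzbar]
    rw [hlin (e θ), hlin (Complex.I * e θ), mul_inv, he1]
    simp only [Complex.mul_re, Complex.mul_im, Complex.I_re, Complex.I_im, Complex.real_smul]
    field_simp
    push_cast
    ring_nf
    simp only [Complex.I_sq]
    ring
  rw [← Complex.integral_comp_polarCoord_symm,
    setIntegral_congr_fun polarCoord.open_target.measurableSet hpt, polarCoord_target,
    integral_const_mul, integral_add hui (hvi.const_mul _), integral_const_mul, hu_int, hv_int]
  ring

/-- **Weyl's lemma** for `∂/∂z̄`: a continuous weak solution is holomorphic. -/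
lemma differentiableOn_of_weak_dzbar_eq_zero {U : Set ℂ} (hU : IsOpen U) {F : ℂ → ℂ}
    (hF : ContinuousOn F U)
    (h : ∀ φ : ℂ → ℂ, ContDiff ℝ ∞ φ → HasCompactSupport φ → tsupport φ ⊆ U →
      ∫ z, F z * dzbar φ z = 0) : DifferentiableOn ℂ F U := by
  intro z₀ hz₀
  refine DifferentiableAt.differentiableWithinAt ?_
  obtain ⟨R, hR, hRU⟩ := Metric.nhds_basis_closedBall.mem_iff.1 (hU.mem_nhds hz₀)
  have hK := isCompact_closedBall z₀ R
  have hFK := hF.mono hRU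
  set k : ℂ → ℂ := (Metric.closedBall z₀ R).indicator F with hk
  have hkint : Integrable k := (integrable_indicator_iff hK.measurableSet).2
    (hFK.integrableOn_compact hK)
  have huc := hK.uniformContinuousOn_of_continuous hFK
  rw [Metric.uniformContinuousOn_iff] at huc
  -- Mollification: the ∂/∂z̄ derivative at x of the convolution with a bump b is, up to sign, the
  -- weak equation tested on s ↦ b(x - s), so the mollified functions are holomorphic. Uniform
  -- continuity of F makes them converge uniformly.
  have key : ∀ n : ℕ, ∃ G : ℂ → ℂ, DifferentiableOn ℂ G (Metric.ball z₀ (R / 2)) ∧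
      ∀ x ∈ Metric.ball z₀ (R / 2), dist (F x) (G x) ≤ 1 / ((n : ℝ) + 1) := by
    intro n
    obtain ⟨δ, hδ, hδF⟩ := huc (1 / ((n : ℝ) + 1)) (by positivity)
    set η := min δ (R / 2) with hη
    have hη0 : 0 < η := lt_min hδ (half_pos hR)
    let ρ : ContDiffBump (0 : ℂ) := ⟨η / 2, η, half_pos hη0, half_lt_self hη0⟩
    set b : ℂ → ℂ := fun w => (ρ.normed volume w : ℂ) with hb
    have hbs : ContDiff ℝ ∞ b := Complex.ofRealCLM.contDiff.comp ρ.contDiff_normed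
    have hbt : tsupport b ⊆ Metric.closedBall 0 η := by
      refine closure_minimal (fun w hw => ?_) Metric.isClosed_closedBall
      have : w ∈ Function.support (ρ.normed volume) := by
        intro h0
        exact hw (by simp [hb, h0])
      rw [ρ.support_normed_eq] at this
      exact Metric.ball_subset_closedBall this
    have hbc : HasCompactSupport b :=
      (isCompact_closedBall 0 η).of_isClosed_subset (isClosed_tsupport _) hbt
    obtain ⟨hG, hGd⟩ := contDiff_and_dzbar_convolution hkint.locallyIntegrable hbs hbc
    have hsub : ∀ x ∈ Metric.ball z₀ (R / 2), Metric.closedBall x η ⊆ Metric.closedBall z₀ R := by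
      intro x hx
      refine Metric.closedBall_subset_closedBall' ?_
      have := min_le_right δ (R / 2)
      have := Metric.mem_ball.1 hx
      linarith
    refine ⟨fun x => ∫ t, k t * b (x - t), fun x hx => ?_, fun x hx => ?_⟩
    · refine DifferentiableAt.differentiableWithinAt ?_
      refine differentiableAt_complex_iff_differentiableAt_real.2
        ⟨hG.differentiable (by simp) x, ?_⟩
      have hzero : dzbar (fun x => ∫ t, k t * b (x - t)) x = 0 := by
        rw [hGd]
        set φ : ℂ → ℂ := fun s => b (x - s) with hφ
        have hφt : tsupport φ ⊆ Metric.closedBall x η := by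
          refine closure_minimal (fun w hw => ?_) Metric.isClosed_closedBall
          have := hbt (subset_tsupport _ (show x - w ∈ Function.support b from hw))
          rw [mem_closedBall_zero_iff] at this
          rwa [Metric.mem_closedBall, dist_comm, dist_eq_norm]
        have hz := h φ (hbs.comp (contDiff_const.sub contDiff_id))
          ((isCompact_closedBall x η).of_isClosed_subset (isClosed_tsupport _) hφt)
          (hφt.trans ((hsub x hx).trans hRU))
        have heq : ∀ t, k t * dzbar b (x - t) = -(F t * dzbar φ t) := by
          intro t
          rw [hφ, dzbar_comp_const_sub x t (hbs.differentiable (by simp))]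
          by_cases ht : t ∈ Metric.closedBall z₀ R
          · rw [hk, indicator_of_mem ht]; ring
          · have h0 : dzbar φ t = 0 :=
              dzbar_eq_zero_of_notMem fun hm => ht (hsub x hx (hφt hm))
            rw [hφ, dzbar_comp_const_sub x t (hbs.differentiable (by simp))] at h0
            rw [neg_eq_zero.1 h0]; ring
        simp only [heq, integral_neg, hz, neg_zero]
      rw [dzbar] at hzero
      rw [smul_eq_mul]
      linear_combination (-2 * Complex.I) * hzero +
        (fderiv ℝ (fun x => ∫ t, k t * b (x - t)) x Complex.I) * Complex.I_sq
    · have hxK : x ∈ Metric.closedBall z₀ R := hsub x hx (Metric.mem_closedBall_self hη0.le)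
      have hconv : ∫ t, k t * b (x - t) =
          convolution (ρ.normed volume) k (ContinuousLinearMap.lsmul ℝ ℝ) volume x := by
        rw [convolution_eq_swap]
        congr 1
        ext t
        simp [hb, mul_comm]
      have hkx : k x = F x := indicator_of_mem hxK F
      change dist (F x) (∫ t, k t * b (x - t)) ≤ _
      rw [hconv, dist_comm, ← hkx]
      refine ContDiffBump.dist_normed_convolution_le hkint.aestronglyMeasurable fun y hy => ?_
      have hy' : dist y x < η := hy
      have hyK : y ∈ Metric.closedBall z₀ R := hsub x hx hy'.le
      rw [hkx, hk, indicator_of_mem hyK]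
      exact (hδF y hyK x hxK (hy'.trans_le (min_le_left _ _))).le
  choose G hGd hGF using key
  have hlim : TendstoUniformlyOn G F atTop (Metric.ball z₀ (R / 2)) := by
    rw [Metric.tendstoUniformlyOn_iff]
    intro ε hε
    filter_upwards [tendsto_one_div_add_atTop_nhds_zero_nat.eventually_lt_const hε] with n hn x hx
    exact (hGF n x hx).trans_lt hn
  exact (hlim.tendstoLocallyUniformlyOn.differentiableOn (Eventually.of_forall hGd)
    Metric.isOpen_ball).differentiableAt (Metric.ball_mem_nhds z₀ (half_pos hR))

/-! ### Norms of the Cauchy kernel, by scaling. -/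

/-- Multiplication by a has real Jacobian |a|². This reduces the kernel estimates to the unit disc,
or to the pair of poles 0 and 1. -/
lemma eLpNorm_eq_mul_eLpNorm_comp_affine (g : ℂ → ℂ) {a : ℂ} (ha : a ≠ 0) (c : ℂ) (r : ℝ≥0∞) :
    eLpNorm g r volume =
      ENNReal.ofReal (‖a‖ ^ (2 / r.toReal)) * eLpNorm (fun u => g (c + a * u)) r volume := by
  have ha' : 0 < ‖a‖ := norm_pos_iff.2 ha
  have hdet : LinearMap.det (LinearMap.mulLeft ℝ a) = ‖a‖ ^ 2 := by
    rw [← Complex.normSq_eq_norm_sq, ← Algebra.norm_complex_apply, Algebra.norm_apply]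
    rfl
  have hmap1 : Measure.map (fun u : ℂ => a * u) volume =
      ENNReal.ofReal (‖a‖ ^ 2)⁻¹ • (volume : Measure ℂ) := by
    have := Measure.map_linearMap_addHaar_eq_smul_addHaar (volume : Measure ℂ)
      (f := LinearMap.mulLeft ℝ a) (by rw [hdet]; positivity)
    rw [hdet, abs_of_pos (by positivity)] at this
    exact this
  have hmap : Measure.map (fun u : ℂ => c + a * u) volume =
      ENNReal.ofReal (‖a‖ ^ 2)⁻¹ • (volume : Measure ℂ) := by
    have hcomp : (fun u : ℂ => c + a * u) = (fun u => c + u) ∘ (fun u => a * u) := rfl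
    rw [hcomp, ← Measure.map_map (by fun_prop) (by fun_prop), hmap1, Measure.map_smul,
      map_add_left_eq_self]
  have hemb : MeasurableEmbedding (fun u : ℂ => c + a * u) :=
    ((Homeomorph.mulLeft₀ a ha).trans (Homeomorph.addLeft c)).measurableEmbedding
  have hκ : ENNReal.ofReal (‖a‖ ^ 2)⁻¹ ≠ 0 := by simpa using ha
  have h1 : eLpNorm (fun u => g (c + a * u)) r volume =
      ENNReal.ofReal (‖a‖ ^ 2)⁻¹ ^ (1 / r).toReal * eLpNorm g r volume := by
    have := hemb.eLpNorm_map_measure (g := g) (p := r) (μ := volume)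
    rw [hmap, eLpNorm_smul_measure_of_ne_zero hκ, smul_eq_mul] at this
    exact this.symm
  have h2 : ENNReal.ofReal (‖a‖ ^ (2 / r.toReal)) *
      ENNReal.ofReal (‖a‖ ^ 2)⁻¹ ^ (1 / r).toReal = 1 := by
    rw [ENNReal.ofReal_rpow_of_pos (by positivity), ← ENNReal.ofReal_mul (by positivity),
      ENNReal.ofReal_eq_one, ← Real.rpow_natCast, ← Real.rpow_neg ha'.le, ← Real.rpow_mul ha'.le, ← Real.rpow_add ha',
      ENNReal.toReal_div]
    have : 2 / r.toReal + -((2 : ℕ) : ℝ) * ((1 : ℝ≥0∞).toReal / r.toReal) = 0 := by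
      push_cast
      rw [ENNReal.toReal_one]
      ring
    rw [this, Real.rpow_zero]
  rw [h1, ← mul_assoc, h2, one_mul]

lemma memLp_inv_restrict_ball {r : ℝ≥0∞} (h1 : 1 ≤ r) (h2 : r < 2) (R : ℝ) :
    MemLp (fun w : ℂ => w⁻¹) r (volume.restrict (Metric.ball 0 R)) := by
  have hr0 : r ≠ 0 := (zero_lt_one.trans_le h1).ne'
  have hrt : r ≠ ⊤ := (h2.trans_le le_top).ne
  have hr2 : r.toReal < 2 := by
    simpa using (ENNReal.toReal_lt_toReal hrt (by simp)).2 h2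
  rw [← integrable_norm_rpow_iff (by fun_prop) hr0 hrt]
  refine integrableOn_ball_of_norm_le_rpow (C := 1) (α := r.toReal) (by simp) (by simpa using hr2)
    (Eventually.of_forall fun w => ?_) (by measurability)
  rw [Real.norm_of_nonneg (by positivity), norm_inv, Real.inv_rpow (norm_nonneg _),
    Real.rpow_neg (norm_nonneg _), one_mul]

/-- The Cauchy kernel on a disc of radius `δ` has `L^r` norm `O(δ^(2/r - 1))`, for `r < 2`. -/
lemma exists_eLpNorm_cauchyKernel_le {r : ℝ≥0∞} (h1 : 1 ≤ r) (h2 : r < 2) :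
    ∃ C : ℝ, 0 < C ∧ ∀ (z z₀ : ℂ) (δ : ℝ), 0 < δ →
      eLpNorm (fun w => (z - w)⁻¹) r (volume.restrict (Metric.ball z₀ δ)) ≤
        ENNReal.ofReal (C * δ ^ (2 / r.toReal - 1)) := by
  set B : Set ℂ := Metric.ball 0 1 with hB
  have hBm : MeasurableSet B := Metric.isOpen_ball.measurableSet
  set κ : ℂ → ℂ := B.indicator (fun w => w⁻¹) with hκ
  set ι : ℂ → ℂ := B.indicator (fun _ => 1) with hι
  have hκm : AEStronglyMeasurable κ volume :=
    (by fun_prop : AEStronglyMeasurable (fun w : ℂ => w⁻¹) volume).indicator hBm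
  have hιm : AEStronglyMeasurable ι volume := aestronglyMeasurable_const.indicator hBm
  have hκfin : eLpNorm κ r volume ≠ ⊤ := by
    rw [hκ, eLpNorm_indicator_eq_eLpNorm_restrict hBm]
    exact (memLp_inv_restrict_ball h1 h2 1).2.ne
  have hιfin : eLpNorm ι r volume ≠ ⊤ :=
    (memLp_indicator_const r hBm 1 (Or.inr measure_ball_lt_top.ne)).2.ne
  set C₀ := eLpNorm κ r volume + eLpNorm ι r volume with hC₀
  have hC₀fin : C₀ ≠ ⊤ := ENNReal.add_ne_top.2 ⟨hκfin, hιfin⟩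
  -- After scaling, the pole ζ can be anywhere. Within distance 1 of it the kernel is a reflected
  -- translate of κ, and further away it is at most 1, so the bound is uniform in ζ.
  have hunit : ∀ ζ : ℂ, eLpNorm (B.indicator fun u => (ζ - u)⁻¹) r volume ≤ C₀ := by
    intro ζ
    have hmp := Measure.measurePreserving_sub_left (volume : Measure ℂ) ζ
    have hle : eLpNorm (B.indicator fun u => (ζ - u)⁻¹) r volume ≤
        eLpNorm ((fun u => ‖κ (ζ - u)‖) + fun u => ‖ι u‖) r volume := by
      refine eLpNorm_mono fun u => ?_
      rw [Pi.add_apply, Real.norm_of_nonneg (by positivity)]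
      by_cases hu : u ∈ B
      · rw [indicator_of_mem hu]
        by_cases hu' : ζ - u ∈ B
        · rw [hκ, indicator_of_mem hu']
          linarith [norm_nonneg (ι u)]
        · have : 1 ≤ ‖ζ - u‖ := by simpa [hB] using hu'
          have h3 : ‖(ζ - u)⁻¹‖ ≤ 1 := by
            rw [norm_inv]
            exact inv_le_one_of_one_le₀ this
          have h4 : ‖ι u‖ = 1 := by simp [hι, hu]
          linarith [norm_nonneg (κ (ζ - u))]
      · rw [indicator_of_notMem hu, norm_zero]
        positivity
    refine hle.trans ((eLpNorm_add_le (hκm.comp_measurePreserving hmp).norm hιm.norm h1).trans ?_)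
    rw [eLpNorm_norm, eLpNorm_norm]
    have := eLpNorm_comp_measurePreserving (p := r) hκm hmp
    rw [hC₀, ← this, Function.comp_def]
  refine ⟨C₀.toReal + 1, by positivity, fun z z₀ δ hδ => ?_⟩
  have hδ0 : (δ : ℂ) ≠ 0 := by exact_mod_cast hδ.ne'
  rw [← eLpNorm_indicator_eq_eLpNorm_restrict Metric.isOpen_ball.measurableSet,
    eLpNorm_eq_mul_eLpNorm_comp_affine _ hδ0 z₀]
  have hfun : (fun u : ℂ => (Metric.ball z₀ δ).indicator (fun w => (z - w)⁻¹) (z₀ + δ * u)) =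
      (δ : ℂ)⁻¹ • B.indicator (fun u => ((z - z₀) / δ - u)⁻¹) := by
    ext u
    have hmem : z₀ + δ * u ∈ Metric.ball z₀ δ ↔ u ∈ B := by
      simp only [hB, Metric.mem_ball, dist_eq_norm, add_sub_cancel_left, norm_mul, sub_zero,
        Complex.norm_real, Real.norm_of_nonneg hδ.le]
      constructor
      · intro h
        by_contra! h'
        nlinarith
      · intro h
        nlinarith
    by_cases hu : u ∈ B
    · rw [indicator_of_mem (hmem.2 hu), Pi.smul_apply, indicator_of_mem hu, smul_eq_mul, ← mul_inv]
      congr 1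
      field_simp
      ring
    · rw [indicator_of_notMem (fun h => hu (hmem.1 h)), Pi.smul_apply, indicator_of_notMem hu,
        smul_zero]
  rw [hfun, eLpNorm_const_smul]
  have hen : ‖(δ : ℂ)⁻¹‖ₑ = ENNReal.ofReal δ⁻¹ := by
    rw [← ofReal_norm, norm_inv, Complex.norm_real, Real.norm_of_nonneg hδ.le]
  have hC₀le : C₀ ≤ ENNReal.ofReal (C₀.toReal + 1) := by
    rw [← ENNReal.ofReal_toReal hC₀fin]
    exact ENNReal.ofReal_le_ofReal (by rw [ENNReal.ofReal_toReal hC₀fin]; linarith)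
  calc _ ≤ ENNReal.ofReal (‖(δ : ℂ)‖ ^ (2 / r.toReal)) *
        (ENNReal.ofReal δ⁻¹ * ENNReal.ofReal (C₀.toReal + 1)) := by
        rw [hen]
        gcongr
        exact (hunit _).trans hC₀le
    _ = _ := by
        rw [← ENNReal.ofReal_mul (by positivity), ← ENNReal.ofReal_mul (by positivity)]
        congr 1
        rw [Complex.norm_real, Real.norm_of_nonneg hδ.le, Real.rpow_sub hδ, Real.rpow_one]
        ring

/-- The difference of two Cauchy kernels has `L^r` norm `O(|z₁ - z₂|^(2/r - 1))`, for
`1 < r < 2`. -/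
lemma exists_eLpNorm_cauchyKernel_sub_le {r : ℝ≥0∞} (h1 : 1 < r) (h2 : r < 2) :
    ∃ C : ℝ, 0 < C ∧ ∀ z₁ z₂ : ℂ, z₁ ≠ z₂ →
      eLpNorm (fun w => (z₁ - w)⁻¹ - (z₂ - w)⁻¹) r volume ≤
        ENNReal.ofReal (C * ‖z₁ - z₂‖ ^ (2 / r.toReal - 1)) := by
  have hr0 : r ≠ 0 := (zero_lt_one.trans h1).ne'
  have hrt : r ≠ ⊤ := (h2.trans_le le_top).ne
  have hr1 : 1 < r.toReal := by
    simpa using (ENNReal.toReal_lt_toReal (by simp) hrt).2 h1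
  -- The poles are integrable to the power r because r < 2, and the decay |u|^(-2) at infinity
  -- because r > 1.
  set κ : ℂ → ℂ := fun u => (0 - u)⁻¹ - (1 - u)⁻¹ with hκ
  have hκm : AEStronglyMeasurable κ volume := by fun_prop
  set B : Set ℂ := Metric.ball 0 2 with hB
  have hBm : MeasurableSet B := Metric.isOpen_ball.measurableSet
  obtain ⟨C, -, hC⟩ := exists_eLpNorm_cauchyKernel_le h1.le h2
  have hnear : eLpNorm (B.indicator κ) r volume < ⊤ := by
    rw [eLpNorm_indicator_eq_eLpNorm_restrict hBm]
    refine (eLpNorm_sub_le (f := fun u : ℂ => (0 - u)⁻¹) (g := fun u : ℂ => (1 - u)⁻¹)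
      (by fun_prop) (by fun_prop) h1.le).trans_lt ?_
    exact ENNReal.add_lt_top.2 ⟨(hC 0 0 2 two_pos).trans_lt ENNReal.ofReal_lt_top,
      (hC 1 0 2 two_pos).trans_lt ENNReal.ofReal_lt_top⟩
  have hfar : eLpNorm (Bᶜ.indicator κ) r volume < ⊤ := by
    -- The constant 5 works since |κ u| ≤ 2/|u|² and 2(1 + t)² ≤ 5t² for t ≥ 2.
    have hj : MemLp (fun u : ℂ => 5 * (1 + ‖u‖) ^ (-2 : ℝ)) r volume := by
      refine MemLp.const_mul ?_ 5
      rw [← integrable_norm_rpow_iff (by measurability) hr0 hrt]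
      have := integrable_one_add_norm (E := ℂ) (μ := volume) (r := 2 * r.toReal)
        (by simp; linarith)
      refine this.congr (Eventually.of_forall fun u => ?_)
      simp only
      rw [Real.norm_of_nonneg (by positivity), ← Real.rpow_mul (by positivity)]
      congr 1
      ring
    refine (eLpNorm_mono (g := fun u : ℂ => 5 * (1 + ‖u‖) ^ (-2 : ℝ)) fun u => ?_).trans_lt hj.2
    rw [Real.norm_of_nonneg (by positivity)]
    by_cases hu : u ∈ Bᶜ
    swap
    · rw [indicator_of_notMem hu, norm_zero]; positivity
    rw [indicator_of_mem hu]
    have hu2 : 2 ≤ ‖u‖ := by simpa [hB] using hu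
    have hu0 : u ≠ 0 := norm_pos_iff.1 (by linarith)
    have hu1 : ‖u‖ / 2 ≤ ‖1 - u‖ := by
      have := norm_sub_norm_le u 1
      rw [norm_sub_rev, norm_one] at this
      linarith
    have hu1' : 1 - u ≠ 0 := norm_pos_iff.1 (by linarith)
    have heq : κ u = -(u * (1 - u))⁻¹ := by
      simp only [hκ, zero_sub]
      field_simp
      ring
    rw [heq, norm_neg, norm_inv, norm_mul, Real.rpow_neg (by positivity), ← div_eq_mul_inv,
      inv_eq_one_div, div_le_div_iff₀ (by nlinarith) (by positivity)]
    have : (1 + ‖u‖) ^ (2 : ℝ) = (1 + ‖u‖) ^ 2 := by norm_cast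
    rw [this]
    nlinarith
  have hfin : eLpNorm κ r volume < ⊤ := by
    rw [← indicator_self_add_compl B κ]
    exact (eLpNorm_add_le (hκm.indicator hBm) (hκm.indicator hBm.compl) h1.le).trans_lt
      (ENNReal.add_lt_top.2 ⟨hnear, hfar⟩)
  refine ⟨(eLpNorm κ r volume).toReal + 1, by positivity, fun z₁ z₂ hz => ?_⟩
  have ha : z₂ - z₁ ≠ 0 := sub_ne_zero.2 hz.symm
  rw [eLpNorm_eq_mul_eLpNorm_comp_affine _ ha z₁]
  have hfun : (fun u : ℂ => (z₁ - (z₁ + (z₂ - z₁) * u))⁻¹ - (z₂ - (z₁ + (z₂ - z₁) * u))⁻¹) =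
      (z₂ - z₁)⁻¹ • κ := by
    ext u
    simp only [hκ, Pi.smul_apply, smul_eq_mul, mul_sub, ← mul_inv]
    congr 2 <;> ring
  rw [hfun, eLpNorm_const_smul]
  have hd : 0 < ‖z₁ - z₂‖ := norm_pos_iff.2 (sub_ne_zero.2 hz)
  have hen : ‖(z₂ - z₁)⁻¹‖ₑ = ENNReal.ofReal ‖z₁ - z₂‖⁻¹ := by
    rw [← ofReal_norm, norm_inv, norm_sub_rev]
  have hle : eLpNorm κ r volume ≤ ENNReal.ofReal ((eLpNorm κ r volume).toReal + 1) := by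
    conv_lhs => rw [← ENNReal.ofReal_toReal hfin.ne]
    exact ENNReal.ofReal_le_ofReal (by linarith)
  calc _ ≤ ENNReal.ofReal (‖z₁ - z₂‖ ^ (2 / r.toReal)) *
        (ENNReal.ofReal ‖z₁ - z₂‖⁻¹ * ENNReal.ofReal ((eLpNorm κ r volume).toReal + 1)) := by
        rw [hen, norm_sub_rev z₂ z₁]
        gcongr
    _ = _ := by
        rw [← ENNReal.ofReal_mul (by positivity), ← ENNReal.ofReal_mul (by positivity)]
        congr 1
        rw [Real.rpow_sub hd, Real.rpow_one]
        ring

/-! ### The Cauchy transform on L^p, p > 2. -/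

/-- The conjugate exponent of `p > 2`. -/
lemma exists_conjExponent {p : ℝ≥0∞} (hp : 2 < p) :
    ∃ r : ℝ≥0∞, ENNReal.HolderConjugate p r ∧ 1 ≤ r ∧ r < 2 ∧ (p ≠ ⊤ → 1 < r) ∧
      2 / r.toReal - 1 = 1 - 2 / p.toReal := by
  have hp0 : p ≠ 0 := (zero_lt_two.trans hp).ne'
  have hinv : p⁻¹ < 2⁻¹ := ENNReal.inv_lt_inv.2 hp
  have hinv1 : p⁻¹ < 1 := hinv.trans (by simp)
  refine ⟨(1 - p⁻¹)⁻¹, ⟨?_⟩, ?_, ?_, ?_, ?_⟩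
  · rw [inv_inv, inv_one]
    exact add_tsub_cancel_of_le hinv1.le
  · rw [ENNReal.one_le_inv]
    exact tsub_le_self
  · rw [ENNReal.inv_lt_iff_inv_lt]
    rw [lt_tsub_iff_right]
    calc (2 : ℝ≥0∞)⁻¹ + p⁻¹ < 2⁻¹ + 2⁻¹ := by
          exact ENNReal.add_lt_add_left (by simp) hinv
      _ = 1 := ENNReal.inv_two_add_inv_two
  · intro hpt
    rw [ENNReal.one_lt_inv]
    exact ENNReal.sub_lt_self ENNReal.one_ne_top one_ne_zero (by simpa using hpt)
  · rw [ENNReal.toReal_inv, ENNReal.toReal_sub_of_le hinv1.le ENNReal.one_ne_top,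
      ENNReal.toReal_inv, ENNReal.toReal_one, div_inv_eq_mul]
    ring

lemma enorm_integral_mul_le {p r : ℝ≥0∞} [ENNReal.HolderConjugate p r] {μ : Measure ℂ}
    {b k : ℂ → ℂ} (hb : AEStronglyMeasurable b μ) (hk : AEStronglyMeasurable k μ) :
    ‖∫ w, b w * k w ∂μ‖ₑ ≤ eLpNorm b p μ * eLpNorm k r μ := by
  have h : eLpNorm (b • k) 1 μ ≤ eLpNorm b p μ * eLpNorm k r μ :=
    eLpNorm_smul_le_mul_eLpNorm hk hb
  refine (enorm_integral_le_lintegral_enorm _).trans (le_trans (le_of_eq ?_) h)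
  rw [eLpNorm_one_eq_lintegral_enorm]
  rfl

/-- The Cauchy transform, a right inverse of `∂/∂z̄`. -/
noncomputable def cauchyTransform (b : ℂ → ℂ) (z : ℂ) : ℂ :=
  (Real.pi : ℂ)⁻¹ * ∫ w, b w * (z - w)⁻¹

lemma norm_pi_inv_mul_le (x : ℂ) : ‖(Real.pi : ℂ)⁻¹ * x‖ ≤ ‖x‖ := by
  rw [norm_mul, norm_inv, Complex.norm_real, Real.norm_of_nonneg Real.pi_pos.le]
  have : Real.pi⁻¹ ≤ 1 := inv_le_one_of_one_le₀ (by linarith [Real.pi_gt_three])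
  nlinarith [norm_nonneg x]

lemma integrable_mul_cauchyKernel {p : ℝ≥0∞} (hp : 2 < p) {b : ℂ → ℂ} (hb : MemLp b p volume)
    {z₀ : ℂ} {δ : ℝ} (hδ : 0 < δ) (hb0 : ∀ w ∉ Metric.ball z₀ δ, b w = 0) (z : ℂ) :
    Integrable (fun w => b w * (z - w)⁻¹) := by
  obtain ⟨r, hpr, h1, h2, -, -⟩ := exists_conjExponent hp
  obtain ⟨C, -, hC⟩ := exists_eLpNorm_cauchyKernel_le h1 h2
  have hk : MemLp (fun w => (z - w)⁻¹) r (volume.restrict (Metric.ball z₀ δ)) :=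
    ⟨by fun_prop, (hC z z₀ δ hδ).trans_lt ENNReal.ofReal_lt_top⟩
  have hint : IntegrableOn (fun w => b w * (z - w)⁻¹) (Metric.ball z₀ δ) :=
    memLp_one_iff_integrable.1 (hk.smul (hb.restrict _))
  exact hint.integrable_of_forall_notMem_eq_zero fun w hw => by rw [hb0 w hw, zero_mul]

/-- The Cauchy transform is bounded from `L^p` of a disc of radius `δ`, `2 < p ≤ ∞`, to bounded
functions, with norm `O(δ^(1 - 2/p))`. -/
lemma exists_norm_cauchyTransform_le {p : ℝ≥0∞} (hp : 2 < p) :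
    ∃ C : ℝ, 0 < C ∧ ∀ (b : ℂ → ℂ) (z₀ : ℂ) (δ N : ℝ), 0 < δ → 0 ≤ N →
      AEStronglyMeasurable b volume → eLpNorm b p volume ≤ ENNReal.ofReal N →
      (∀ w ∉ Metric.ball z₀ δ, b w = 0) →
      ∀ z, ‖cauchyTransform b z‖ ≤ C * δ ^ (1 - 2 / p.toReal) * N := by
  obtain ⟨r, hpr, h1, h2, -, hexp⟩ := exists_conjExponent hp
  obtain ⟨C, hC0, hC⟩ := exists_eLpNorm_cauchyKernel_le h1 h2
  refine ⟨C, hC0, fun b z₀ δ N hδ hN hbm hb hb0 z => (norm_pi_inv_mul_le _).trans ?_⟩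
  have hset : ∫ w, b w * (z - w)⁻¹ = ∫ w in Metric.ball z₀ δ, b w * (z - w)⁻¹ :=
    (setIntegral_eq_integral_of_forall_compl_eq_zero fun w hw => by rw [hb0 w hw, zero_mul]).symm
  have h := enorm_integral_mul_le (p := p) (r := r) (μ := volume.restrict (Metric.ball z₀ δ))
    (k := fun w => (z - w)⁻¹) hbm.restrict (by fun_prop)
  rw [← hset, ← ofReal_norm] at h
  have h' := h.trans (mul_le_mul' ((eLpNorm_mono_measure b Measure.restrict_le_self).trans hb)
    (hC z z₀ δ hδ))
  rw [← ENNReal.ofReal_mul hN, ENNReal.ofReal_le_ofReal_iff (by positivity), hexp] at h'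
  linarith

/-- The Cauchy transform of a compactly supported `L^p` function, `2 < p < ∞`, is Hölder
continuous with exponent `1 - 2/p`. -/
lemma exists_norm_cauchyTransform_sub_le {p : ℝ≥0∞} (hp : 2 < p) (hpt : p ≠ ⊤) {b : ℂ → ℂ}
    (hb : MemLp b p volume) {z₀ : ℂ} {δ : ℝ} (hδ : 0 < δ)
    (hb0 : ∀ w ∉ Metric.ball z₀ δ, b w = 0) :
    ∃ C : ℝ, 0 ≤ C ∧ ∀ z₁ z₂, ‖cauchyTransform b z₁ - cauchyTransform b z₂‖ ≤
      C * ‖z₁ - z₂‖ ^ (1 - 2 / p.toReal) := by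
  obtain ⟨r, hpr, -, h2, h1, hexp⟩ := exists_conjExponent hp
  obtain ⟨C, hC0, hC⟩ := exists_eLpNorm_cauchyKernel_sub_le (h1 hpt) h2
  refine ⟨(eLpNorm b p volume).toReal * C, by positivity, fun z₁ z₂ => ?_⟩
  rcases eq_or_ne z₁ z₂ with rfl | hz
  · rw [sub_self, norm_zero]; positivity
  have hi := integrable_mul_cauchyKernel hp hb hδ hb0
  rw [cauchyTransform, cauchyTransform, ← mul_sub, ← integral_sub (hi z₁) (hi z₂)]
  refine (norm_pi_inv_mul_le _).trans ?_
  simp only [← mul_sub]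
  have h := enorm_integral_mul_le (p := p) (r := r) (μ := volume)
    (k := fun w => (z₁ - w)⁻¹ - (z₂ - w)⁻¹) hb.1 (by fun_prop)
  rw [← ofReal_norm, ← ENNReal.ofReal_toReal hb.2.ne] at h
  have h' := h.trans (mul_le_mul' le_rfl (hC z₁ z₂ hz))
  rw [← ENNReal.ofReal_mul (by positivity), ENNReal.ofReal_le_ofReal_iff (by positivity),
    hexp] at h'
  linarith

/-- The Cauchy transform of a test function is smooth, and solves the `∂/∂z̄` equation. -/
lemma contDiff_and_dzbar_cauchyTransform {b : ℂ → ℂ} (hb : ContDiff ℝ ∞ b)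
    (hcb : HasCompactSupport b) :
    ContDiff ℝ ∞ (cauchyTransform b) ∧ ∀ z, dzbar (cauchyTransform b) z = b z := by
  -- Substituting w = z - t puts z into the argument of the smooth factor, where it can be
  -- differentiated; Cauchy–Pompeiu for s ↦ b(z - s) then evaluates the result.
  have heq : cauchyTransform b =
      fun z => ∫ t, ((Real.pi : ℂ)⁻¹ * t⁻¹) * b (z - t) := by
    ext z
    rw [cauchyTransform, ← integral_sub_left_eq_self _ volume z, ← integral_const_mul]
    congr 1
    ext t
    rw [sub_sub_cancel]
    ring
  have hk : LocallyIntegrable (fun t : ℂ => (Real.pi : ℂ)⁻¹ * t⁻¹) :=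
    locallyIntegrable_inv.smul (Real.pi : ℂ)⁻¹
  obtain ⟨h1, h2⟩ := contDiff_and_dzbar_convolution hk hb hcb
  rw [heq]
  refine ⟨h1, fun z => ?_⟩
  rw [h2]
  have hpi : (Real.pi : ℂ) ≠ 0 := by exact_mod_cast Real.pi_ne_zero
  have hcp := integral_inv_mul_dzbar (b := fun s => b (z - s))
    (hb.comp (contDiff_const.sub contDiff_id))
    (hcb.comp_homeomorph (Homeomorph.subLeft z))
  simp only [dzbar_comp_const_sub z _ (hb.differentiable (by simp)), sub_zero, mul_neg,
    integral_neg] at hcp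
  simp only [mul_assoc, integral_const_mul]
  rw [← neg_neg (∫ a : ℂ, a⁻¹ * dzbar b (z - a)), hcp]
  field_simp

/-! ### The weak product rule. -/

/-- A locally integrable function times a continuous function with compact support is
integrable. -/
lemma integrable_mul_of_tsupport_subset {V : Set ℂ} {h φ : ℂ → ℂ} (hh : LocallyIntegrableOn h V)
    (hφ : Continuous φ) (hcφ : HasCompactSupport φ) (hφV : tsupport φ ⊆ V) :
    Integrable (fun z => h z * φ z) := by
  have h1 : IntegrableOn (fun z => h z * φ z) (tsupport φ) :=
    (hh.integrableOn_compact_subset hφV hcφ).mul_continuousOn hφ.continuousOn hcφ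
  exact h1.integrable_of_forall_notMem_eq_zero fun z hz => by
    rw [image_eq_zero_of_notMem_tsupport hz, mul_zero]

lemma tsupport_dzbar_subset (φ : ℂ → ℂ) : tsupport (dzbar φ) ⊆ tsupport φ :=
  closure_minimal (support_dzbar_subset φ) (isClosed_tsupport _)

lemma cauchyTransform_sub {p : ℝ≥0∞} (hp : 2 < p) {b b' : ℂ → ℂ} (hb : MemLp b p volume)
    (hb' : MemLp b' p volume) {z₀ : ℂ} {δ : ℝ} (hδ : 0 < δ)
    (hb0 : ∀ w ∉ Metric.ball z₀ δ, b w = 0) (hb0' : ∀ w ∉ Metric.ball z₀ δ, b' w = 0) (z : ℂ) :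
    cauchyTransform b z - cauchyTransform b' z = cauchyTransform (fun w => b w - b' w) z := by
  rw [cauchyTransform, cauchyTransform, cauchyTransform, ← mul_sub,
    ← integral_sub (integrable_mul_cauchyKernel hp hb hδ hb0 z)
      (integrable_mul_cauchyKernel hp hb' hδ hb0' z)]
  simp only [sub_mul]

lemma continuous_cauchyTransform {p : ℝ≥0∞} (hp : 2 < p) (hpt : p ≠ ⊤) {b : ℂ → ℂ}
    (hb : MemLp b p volume) {z₀ : ℂ} {δ : ℝ} (hδ : 0 < δ)
    (hb0 : ∀ w ∉ Metric.ball z₀ δ, b w = 0) : Continuous (cauchyTransform b) := by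
  obtain ⟨C, -, hC⟩ := exists_norm_cauchyTransform_sub_le hp hpt hb hδ hb0
  have hp2 : 2 < p.toReal := by simpa using (ENNReal.toReal_lt_toReal (by simp) hpt).2 hp
  have hs : 0 < 1 - 2 / p.toReal := by
    rw [sub_pos, div_lt_one (by linarith)]
    exact hp2
  refine continuous_iff_continuousAt.2 fun z => ?_
  rw [ContinuousAt, tendsto_iff_norm_sub_tendsto_zero]
  refine squeeze_zero (fun _ => norm_nonneg _) (fun w => hC w z) ?_
  have : Continuous fun w : ℂ => C * ‖w - z‖ ^ (1 - 2 / p.toReal) :=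
    continuous_const.mul ((continuous_id.sub continuous_const).norm.rpow_const
      fun _ => Or.inr hs.le)
  simpa [Real.zero_rpow hs.ne'] using this.tendsto z

/-- Approximation in `L^p` by test functions, with control of the support. -/
lemma exists_contDiff_approx_of_ball {p : ℝ≥0∞} (hp : 2 < p) (hpt : p ≠ ⊤) {b : ℂ → ℂ}
    (hb : MemLp b p volume) {z₀ : ℂ} {δ : ℝ} (hδ : 0 < δ)
    (hb0 : ∀ w ∉ Metric.ball z₀ δ, b w = 0) {ε : ℝ} (hε : 0 < ε) :
    ∃ b' : ℂ → ℂ, ContDiff ℝ ∞ b' ∧ HasCompactSupport b' ∧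
      (∀ w ∉ Metric.ball z₀ (2 * δ), b' w = 0) ∧
      eLpNorm (fun w => b w - b' w) p volume ≤ ENNReal.ofReal ε := by
  have hp1 : 1 ≤ p := one_le_two.trans hp.le
  obtain ⟨g, -, hg, hbg⟩ := hb.exist_eLpNorm_sub_le hpt hp1 hε
  -- The cutoff is 1 where b lives, so it does not increase the error pointwise, and it confines the
  -- approximant to the disc of radius 2δ.
  let ρ : ContDiffBump z₀ := ⟨δ, 2 * δ, hδ, by linarith⟩
  refine ⟨fun w => (ρ w : ℂ) * g w, (Complex.ofRealCLM.contDiff.comp ρ.contDiff).mul hg,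
    ?_, fun w hw => ?_, ?_⟩
  · refine HasCompactSupport.mul_right ?_
    exact ρ.hasCompactSupport.comp_left Complex.ofReal_zero
  · have : w ∉ Function.support ρ := by rwa [ρ.support_eq]
    simp [Function.notMem_support.1 this]
  · refine (eLpNorm_mono fun w => ?_).trans hbg
    rw [Pi.sub_apply]
    by_cases hw : w ∈ Metric.ball z₀ δ
    · have : ρ w = 1 := ρ.one_of_mem_closedBall (Metric.ball_subset_closedBall hw)
      simp [this]
    · rw [hb0 w hw]
      simp only [zero_sub, norm_neg, norm_mul, Complex.norm_real, Real.norm_of_nonneg ρ.nonneg]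
      exact mul_le_of_le_one_left (norm_nonneg _) ρ.le_one

/-- Weak product rule for `∂/∂z̄`, one factor being a Cauchy transform plus a constant. -/
lemma weak_dzbar_mul_cauchyTransform {V : Set ℂ} (hV : IsOpen V) {u h : ℂ → ℂ}
    (hu : ContinuousOn u V) (hh : LocallyIntegrableOn h V)
    (hw : ∀ ψ : ℂ → ℂ, ContDiff ℝ ∞ ψ → HasCompactSupport ψ → tsupport ψ ⊆ V →
      ∫ z, u z * dzbar ψ z = -∫ z, h z * ψ z)
    {p : ℝ≥0∞} (hp : 2 < p) (hpt : p ≠ ⊤) {b : ℂ → ℂ} (hb : MemLp b p volume) {z₀ : ℂ} {δ : ℝ}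
    (hδ : 0 < δ) (hb0 : ∀ w ∉ Metric.ball z₀ δ, b w = 0) (s : ℂ)
    {φ : ℂ → ℂ} (hφ : ContDiff ℝ ∞ φ) (hcφ : HasCompactSupport φ) (hφV : tsupport φ ⊆ V) :
    Integrable (fun z => u z * dzbar φ z * (s + cauchyTransform b z)) ∧
    Integrable (fun z => b z * (u z * φ z)) ∧
    Integrable (fun z => h z * φ z * (s + cauchyTransform b z)) ∧
    ∫ z, u z * dzbar φ z * (s + cauchyTransform b z) =
      -(∫ z, b z * (u z * φ z)) - ∫ z, h z * φ z * (s + cauchyTransform b z) := by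
  have hp1 : 1 ≤ p := one_le_two.trans hp.le
  have hul : LocallyIntegrableOn u V := hu.locallyIntegrableOn hV.measurableSet
  have hw1 : Integrable (fun z => u z * dzbar φ z) :=
    integrable_mul_of_tsupport_subset hul (continuous_dzbar hφ) (hasCompactSupport_dzbar hcφ)
      ((tsupport_dzbar_subset φ).trans hφV)
  have hw3 : Integrable (fun z => h z * φ z) :=
    integrable_mul_of_tsupport_subset hh hφ.continuous hcφ hφV
  have hts : tsupport (fun z => u z * φ z) ⊆ tsupport φ := tsupport_mul_subset_right
  have hcs : HasCompactSupport (fun z => u z * φ z) := hcφ.mul_left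
  have hw2c : Continuous (fun z => u z * φ z) :=
    (hu.mul hφ.continuous.continuousOn).continuous_of_tsupport_subset hV (hts.trans hφV)
  obtain ⟨r, hpr, h1, h2, -, -⟩ := exists_conjExponent hp
  have hw2 : MemLp (fun z => u z * φ z) r volume := hw2c.memLp_of_hasCompactSupport hcs
  obtain ⟨C, hC0, hC⟩ := exists_norm_cauchyTransform_le hp
  have h2δ : 0 < 2 * δ := by linarith
  have hb02 : ∀ w ∉ Metric.ball z₀ (2 * δ), b w = 0 := fun w hw =>
    hb0 w fun hm => hw (Metric.ball_subset_ball (by linarith) hm)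
  -- integrability against a bounded continuous Cauchy transform
  have hbdd : ∀ b' : ℂ → ℂ, MemLp b' p volume → (∀ w ∉ Metric.ball z₀ (2 * δ), b' w = 0) →
      ∀ w : ℂ → ℂ, Integrable w → Integrable (fun z => w z * cauchyTransform b' z) := by
    intro b' hb' hb0' w hwi
    refine hwi.mul_bdd (c := C * (2 * δ) ^ (1 - 2 / p.toReal) * (eLpNorm b' p volume).toReal)
      (continuous_cauchyTransform hp hpt hb' h2δ hb0').aestronglyMeasurable
      (Eventually.of_forall fun z => ?_)
    exact hC b' z₀ (2 * δ) _ h2δ ENNReal.toReal_nonneg hb'.1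
      (by rw [ENNReal.ofReal_toReal hb'.2.ne]) hb0' z
  have hbdds : ∀ b' : ℂ → ℂ, MemLp b' p volume → (∀ w ∉ Metric.ball z₀ (2 * δ), b' w = 0) →
      ∀ w : ℂ → ℂ, Integrable w → Integrable (fun z => w z * (s + cauchyTransform b' z)) := by
    intro b' hb' hb0' w hwi
    simp only [mul_add]
    exact (hwi.mul_const s).add (hbdd b' hb' hb0' w hwi)
  have hbint : ∀ b' : ℂ → ℂ, MemLp b' p volume → Integrable (fun z => b' z * (u z * φ z)) :=
    fun b' hb' => memLp_one_iff_integrable.1 (hw2.smul hb')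
  refine ⟨hbdds b hb hb02 _ hw1, hbint b hb, hbdds b hb hb02 _ hw3, ?_⟩
  -- Δ is the defect of the product rule. It vanishes for smooth b, and is continuous in b for the
  -- L^p norm: the Cauchy transform is controlled uniformly, and uφ lies in the dual L^r.
  -- Approximation by test functions concludes.
  set Δ : ℂ := (∫ z, u z * dzbar φ z * (s + cauchyTransform b z)) +
    (∫ z, b z * (u z * φ z)) + ∫ z, h z * φ z * (s + cauchyTransform b z) with hΔ
  suffices hzero : Δ = 0 by rw [hΔ] at hzero; linear_combination hzero
  set K : ℝ := (∫ z, ‖u z * dzbar φ z‖) * (C * (2 * δ) ^ (1 - 2 / p.toReal)) +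
    (eLpNorm (fun z => u z * φ z) r volume).toReal +
    (∫ z, ‖h z * φ z‖) * (C * (2 * δ) ^ (1 - 2 / p.toReal)) with hK
  have hbound : ∀ ε : ℝ, 0 < ε → ‖Δ‖ ≤ K * ε := by
    intro ε hε
    obtain ⟨b', hb's, hb'c, hb'0, hbb'⟩ := exists_contDiff_approx_of_ball hp hpt hb hδ hb0 hε
    have hb' : MemLp b' p volume := hb's.continuous.memLp_of_hasCompactSupport hb'c
    have hd : MemLp (fun w => b w - b' w) p volume := hb.sub hb'
    have hd0 : ∀ w ∉ Metric.ball z₀ (2 * δ), b w - b' w = 0 := fun w hw => by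
      rw [hb02 w hw, hb'0 w hw, sub_zero]
    obtain ⟨hTs, hTd⟩ := contDiff_and_dzbar_cauchyTransform hb's hb'c
    set τ : ℂ → ℂ := cauchyTransform (fun w => b w - b' w) with hτ
    have hτb : ∀ z, ‖τ z‖ ≤ C * (2 * δ) ^ (1 - 2 / p.toReal) * ε :=
      hC _ z₀ (2 * δ) ε h2δ hε.le hd.1 hbb' hd0
    have hτe : ∀ z, s + cauchyTransform b z = (s + cauchyTransform b' z) + τ z := by
      intro z
      rw [hτ, ← cauchyTransform_sub hp hb hb' h2δ hb02 hb'0]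
      ring
    have hsm : ContDiff ℝ ∞ (fun z => s + cauchyTransform b' z) := contDiff_const.add hTs
    have hdz : ∀ z, dzbar (fun z => s + cauchyTransform b' z) z = b' z := by
      intro z
      rw [← hTd z, dzbar, dzbar, fderiv_const_add]
    -- For smooth b' the factor s + T b' is smooth, so it can be absorbed into the test function.
    have hid := hw (fun z => (s + cauchyTransform b' z) * φ z) (hsm.mul hφ) hcφ.mul_left
      (tsupport_mul_subset_right.trans hφV)
    have hid' : ∫ z, u z * dzbar (fun z => (s + cauchyTransform b' z) * φ z) z =
        (∫ z, b' z * (u z * φ z)) + ∫ z, u z * dzbar φ z * (s + cauchyTransform b' z) := by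
      rw [← integral_add (hbint b' hb') (hbdds b' hb' hb'0 _ hw1)]
      congr 1
      ext z
      rw [dzbar_mul (hsm.differentiable (by simp) z) (hφ.differentiable (by simp) z), hdz]
      ring
    have hid'' : ∫ z, h z * ((s + cauchyTransform b' z) * φ z) =
        ∫ z, h z * φ z * (s + cauchyTransform b' z) := by
      congr 1
      ext z
      ring
    rw [hid', hid''] at hid
    have e1 : ∫ z, u z * dzbar φ z * (s + cauchyTransform b z) =
        (∫ z, u z * dzbar φ z * (s + cauchyTransform b' z)) + ∫ z, u z * dzbar φ z * τ z := by
      rw [← integral_add (hbdds b' hb' hb'0 _ hw1) (hbdd _ hd hd0 _ hw1)]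
      simp only [hτe, mul_add]
      rfl
    have e3 : ∫ z, h z * φ z * (s + cauchyTransform b z) =
        (∫ z, h z * φ z * (s + cauchyTransform b' z)) + ∫ z, h z * φ z * τ z := by
      rw [← integral_add (hbdds b' hb' hb'0 _ hw3) (hbdd _ hd hd0 _ hw3)]
      simp only [hτe, mul_add]
      rfl
    have e2 : ∫ z, b z * (u z * φ z) =
        (∫ z, b' z * (u z * φ z)) + ∫ z, (b z - b' z) * (u z * φ z) := by
      rw [← integral_add (hbint b' hb') (hbint _ hd)]
      congr 1
      ext z
      ring
    have hΔe : Δ = (∫ z, u z * dzbar φ z * τ z) + (∫ z, (b z - b' z) * (u z * φ z)) +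
        ∫ z, h z * φ z * τ z := by
      rw [hΔ, e1, e2, e3]
      linear_combination hid
    have n13 : ∀ w : ℂ → ℂ, Integrable w →
        ‖∫ z, w z * τ z‖ ≤ (∫ z, ‖w z‖) * (C * (2 * δ) ^ (1 - 2 / p.toReal)) * ε := by
      intro w hwi
      rw [mul_assoc, ← integral_mul_const]
      refine norm_integral_le_of_norm_le (hwi.norm.mul_const _) (Eventually.of_forall fun z => ?_)
      rw [norm_mul]
      exact mul_le_mul_of_nonneg_left (hτb z) (norm_nonneg _)
    have n2 : ‖∫ z, (b z - b' z) * (u z * φ z)‖ ≤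
        (eLpNorm (fun z => u z * φ z) r volume).toReal * ε := by
      have := (enorm_integral_mul_le (p := p) (r := r) hd.1 hw2.1).trans
        (mul_le_mul' hbb' le_rfl)
      rw [← ofReal_norm, ← ENNReal.ofReal_toReal hw2.2.ne, ← ENNReal.ofReal_mul hε.le,
        ENNReal.ofReal_le_ofReal_iff (by positivity)] at this
      linarith
    rw [hΔe, hK]
    refine (norm_add₃_le).trans ?_
    linarith [n13 _ hw1, n13 _ hw3]
  have hK0 : 0 ≤ K := by positivity
  by_contra hne
  have hpos : 0 < ‖Δ‖ := norm_pos_iff.2 hne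
  have := hbound (‖Δ‖ / (2 * (K + 1))) (by positivity)
  rw [mul_div_assoc', le_div_iff₀ (by positivity)] at this
  nlinarith

/-! ### The gauge as a fixed point. -/

/-- A disc has finite measure. This is how p = ∞ is handled: at finite exponents test functions are
dense and the difference of two Cauchy kernels has a conjugate exponent r > 1. -/
lemma MeasureTheory.MemLp.of_le_exponent_of_ball {p q : ℝ≥0∞} (hqp : q ≤ p) {b : ℂ → ℂ}
    (hb : MemLp b p volume) {z₀ : ℂ} {δ : ℝ} (hb0 : ∀ w ∉ Metric.ball z₀ δ, b w = 0) :
    MemLp b q volume := by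
  have hfin : IsFiniteMeasure (volume.restrict (Metric.ball z₀ δ)) :=
    isFiniteMeasure_restrict.2 measure_ball_lt_top.ne
  have h1 : MemLp b q (volume.restrict (Metric.ball z₀ δ)) :=
    (hb.restrict (Metric.ball z₀ δ)).mono_exponent hqp
  have h2 : (Metric.ball z₀ δ).indicator b = b := by
    ext w
    by_cases hw : w ∈ Metric.ball z₀ δ
    · rw [indicator_of_mem hw]
    · rw [indicator_of_notMem hw, hb0 w hw]
  rw [← h2]
  exact (memLp_indicator_iff_restrict Metric.isOpen_ball.measurableSet).2 h1

lemma holderWith_cauchyTransform {p : ℝ≥0∞} (hp : 2 < p) (hpt : p ≠ ⊤) {b : ℂ → ℂ}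
    (hb : MemLp b p volume) {z₀ : ℂ} {δ : ℝ} (hδ : 0 < δ)
    (hb0 : ∀ w ∉ Metric.ball z₀ δ, b w = 0) :
    ∃ C : ℝ≥0, HolderWith C (1 - 2 / p.toReal).toNNReal (cauchyTransform b) := by
  obtain ⟨C, hC0, hC⟩ := exists_norm_cauchyTransform_sub_le hp hpt hb hδ hb0
  have hp2 : 2 < p.toReal := by simpa using (ENNReal.toReal_lt_toReal (by simp) hpt).2 hp
  have hs : 0 ≤ 1 - 2 / p.toReal := by
    rw [sub_nonneg, div_le_one (by linarith)]
    exact hp2.le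
  refine ⟨C.toNNReal, fun x y => ?_⟩
  rw [edist_dist, edist_dist, Real.coe_toNNReal _ hs, dist_eq_norm, dist_eq_norm,
    ENNReal.ofReal_rpow_of_nonneg (norm_nonneg _) hs]
  change _ ≤ ENNReal.ofReal C * _
  rw [← ENNReal.ofReal_mul hC0]
  exact ENNReal.ofReal_le_ofReal (hC x y)

lemma exists_finite_exponent {p : ℝ≥0∞} (hp : 2 < p) : ∃ q : ℝ≥0∞, 2 < q ∧ q ≠ ⊤ ∧ q ≤ p := by
  obtain ⟨q, h1, h2⟩ := exists_between hp
  exact ⟨q, h1, (h2.trans_le le_top).ne, h2.le⟩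

lemma memLp_sum_mul {m : ℕ} {p : ℝ≥0∞} (hp : 1 ≤ p) {G B : ℂ → Fin m → ℂ} {K M : ℝ}
    (hK : 0 ≤ K) (hG : ∀ l, Continuous fun w => G w l) (hGK : ∀ w l, ‖G w l‖ ≤ K)
    (hB : ∀ l, MemLp (fun w => B w l) p volume)
    (hBM : ∀ l, eLpNorm (fun w => B w l) p volume ≤ ENNReal.ofReal M) :
    MemLp (fun w => ∑ l, G w l * B w l) p volume ∧
      eLpNorm (fun w => ∑ l, G w l * B w l) p volume ≤ ENNReal.ofReal (m * (K * M)) := by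
  have hm : ∀ l, AEStronglyMeasurable (fun w => G w l * B w l) volume := fun l =>
    (hG l).aestronglyMeasurable.mul (hB l).1
  have hle : ∀ l, eLpNorm (fun w => G w l * B w l) p volume ≤ ENNReal.ofReal (K * M) := by
    intro l
    refine (eLpNorm_le_mul_eLpNorm_of_ae_le_mul (c := K) (g := fun w => B w l)
      (Eventually.of_forall fun w => ?_) p).trans ?_
    · rw [norm_mul]
      exact mul_le_mul_of_nonneg_right (hGK w l) (norm_nonneg _)
    · rw [ENNReal.ofReal_mul hK]
      gcongr
      exact hBM l
  have hsum : eLpNorm (fun w => ∑ l, G w l * B w l) p volume ≤ ENNReal.ofReal (m * (K * M)) := by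
    have h1 : (fun w => ∑ l, G w l * B w l) = ∑ l, fun w => G w l * B w l := by
      ext w; simp
    rw [h1]
    refine (eLpNorm_sum_le (fun l _ => hm l) hp).trans
      ((Finset.sum_le_sum fun l _ => hle l).trans ?_)
    rw [Finset.sum_const, Finset.card_univ, Fintype.card_fin, nsmul_eq_mul,
      ENNReal.ofReal_mul m.cast_nonneg, ENNReal.ofReal_natCast]
  exact ⟨⟨Finset.aestronglyMeasurable_fun_sum _ fun l _ => hm l,
    hsum.trans_lt ENNReal.ofReal_lt_top⟩, hsum⟩

/-- The absolute row sums of g are below 1, so 1 + g is strictly diagonally dominant. -/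
lemma isUnit_one_add_of_norm_le {m : ℕ} {g : Matrix (Fin m) (Fin m) ℂ} {η : ℝ}
    (hg : ∀ j k, ‖g j k‖ ≤ η) (hη : m * η < 1) : IsUnit (1 + g) := by
  rw [Matrix.isUnit_iff_isUnit_det, isUnit_iff_ne_zero]
  refine det_ne_zero_of_sum_row_lt_diag fun k => ?_
  have h1 : ∑ j ∈ Finset.univ.erase k, ‖(1 + g) k j‖ = ∑ j ∈ Finset.univ.erase k, ‖g k j‖ := by
    refine Finset.sum_congr rfl fun j hj => ?_
    rw [Matrix.add_apply, Matrix.one_apply_ne (Finset.ne_of_mem_erase hj).symm, zero_add]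
  have h2 : ∑ j ∈ Finset.univ.erase k, ‖g k j‖ + ‖g k k‖ = ∑ j, ‖g k j‖ :=
    Finset.sum_erase_add _ _ (Finset.mem_univ k)
  have h3 : ∑ j, ‖g k j‖ ≤ m * η := by
    refine (Finset.sum_le_sum fun j _ => hg k j).trans ?_
    simp
  have h4 : 1 - ‖g k k‖ ≤ ‖(1 + g) k k‖ := by
    rw [Matrix.add_apply, Matrix.one_apply_eq]
    have := norm_sub_norm_le (1 : ℂ) (-g k k)
    rwa [norm_one, norm_neg, sub_neg_eq_add] at this
  rw [h1]
  linarith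

/-- Solution of the integral form of `∂(1 + g)/∂z̄ = -(1 + g) B` by a contraction argument. -/
lemma exists_gauge (m : ℕ) {p : ℝ≥0∞} (hp : 2 < p) :
    ∃ ε c : ℝ, 0 < ε ∧ 0 < c ∧ ∀ (z₀ : ℂ) (δ M : ℝ) (B : ℂ → Matrix (Fin m) (Fin m) ℂ),
      0 < δ → 0 ≤ M → (∀ j k, MemLp (fun w => B w j k) p volume) →
      (∀ j k, eLpNorm (fun w => B w j k) p volume ≤ ENNReal.ofReal M) →
      (∀ w ∉ Metric.ball z₀ δ, B w = 0) → M * δ ^ (1 - 2 / p.toReal) < ε →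
      ∃ g : ℂ → Matrix (Fin m) (Fin m) ℂ, (∀ w, IsUnit (1 + g w)) ∧
        (∀ w j k, ‖g w j k‖ ≤ c * M * δ ^ (1 - 2 / p.toReal)) ∧
        ∀ j k, ∃ b : ℂ → ℂ, MemLp b p volume ∧ (∀ w ∉ Metric.ball z₀ δ, b w = 0) ∧
          (∀ w, b w = -∑ l, (1 + g w) j l * B w l k) ∧ ∀ w, g w j k = cauchyTransform b w := by
  have hp1 : 1 ≤ p := one_le_two.trans hp.le
  obtain ⟨q, hq, hqt, hqp⟩ := exists_finite_exponent hp
  obtain ⟨C, hC0, hC⟩ := exists_norm_cauchyTransform_le hp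
  -- The map below has Lipschitz constant κ = C m M s. This ε gives 4(m + 1)κ ≤ 1, hence both κ ≤
  -- 1/4 for the contraction and 2mκ < 1 for invertibility; c comes from ‖g‖ ≤ 2κ. Using m + 1 keeps
  -- the constants positive when m = 0.
  refine ⟨1 / (4 * C * (m + 1) ^ 2), 2 * C * (m + 1), by positivity, by positivity,
    fun z₀ δ M B hδ hM hB hBM hB0 hsmall => ?_⟩
  set s := δ ^ (1 - 2 / p.toReal) with hs
  have hs0 : 0 < s := by positivity
  set κ : ℝ := C * m * M * s with hκ
  have hκ0 : 0 ≤ κ := by positivity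
  have hκs : κ * (4 * (m + 1)) ≤ 1 := by
    rw [lt_div_iff₀ (by positivity)] at hsmall
    have : κ * (4 * (m + 1)) ≤ M * s * (4 * C * (m + 1) ^ 2) := by
      have h0 : 0 ≤ C * M * s * (m + 1) := by positivity
      rw [hκ]
      nlinarith
    linarith
  have hκ2 : κ ≤ 1 / 4 := by
    nlinarith [(Nat.cast_nonneg m : (0 : ℝ) ≤ m)]
  -- the density `∑ G_jl B_lk` and its Cauchy transform
  set D : (ℂ → Fin m → Fin m → ℂ) → Fin m → Fin m → ℂ → ℂ :=
    fun G j k w => -∑ l, G w j l * B w l k with hD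
  have hDmem : ∀ (G : ℂ → Fin m → Fin m → ℂ) (K : ℝ), 0 ≤ K → Continuous G →
      (∀ w j l, ‖G w j l‖ ≤ K) → ∀ j k, MemLp (D G j k) p volume ∧
        eLpNorm (D G j k) p volume ≤ ENNReal.ofReal (m * (K * M)) := by
    intro G K hK hG hGK j k
    have := memLp_sum_mul hp1 (G := fun w => G w j) (B := fun w l => B w l k) hK
      (fun l => by fun_prop) (fun w l => hGK w j l) (fun l => hB l k) (fun l => hBM l k)
    refine ⟨this.1.neg, ?_⟩
    have h2 := eLpNorm_neg (fun w => ∑ l, G w j l * B w l k) p volume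
    exact (h2.le).trans this.2
  have hD0 : ∀ G j k, ∀ w ∉ Metric.ball z₀ δ, D G j k w = 0 := by
    intro G j k w hw
    simp [hD, hB0 w hw]
  have hTle : ∀ (G : ℂ → Fin m → Fin m → ℂ) (K : ℝ), 0 ≤ K → Continuous G →
      (∀ w j l, ‖G w j l‖ ≤ K) → ∀ j k z, ‖cauchyTransform (D G j k) z‖ ≤ κ * K := by
    intro G K hK hG hGK j k z
    obtain ⟨h1, h2⟩ := hDmem G K hK hG hGK j k
    refine (hC _ z₀ δ _ hδ (by positivity) h1.1 h2 (hD0 G j k) z).trans (le_of_eq ?_)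
    rw [hκ]
    ring
  have hTc : ∀ (G : ℂ → Fin m → Fin m → ℂ) (K : ℝ), 0 ≤ K → Continuous G →
      (∀ w j l, ‖G w j l‖ ≤ K) → ∀ j k, Continuous (cauchyTransform (D G j k)) := by
    intro G K hK hG hGK j k
    exact continuous_cauchyTransform hq hqt
      ((hDmem G K hK hG hGK j k).1.of_le_exponent_of_ball hqp (hD0 G j k)) hδ (hD0 G j k)
  let one : Fin m → Fin m → ℂ := fun j k => (1 : Matrix (Fin m) (Fin m) ℂ) j k
  have hone : ∀ j k, ‖one j k‖ ≤ 1 := by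
    intro j k
    by_cases h : j = k
    · simp [one, h]
    · simp [one, Matrix.one_apply_ne h]
  have hentry : ∀ (g : BoundedContinuousFunction ℂ (Fin m → Fin m → ℂ)) w j l,
      ‖g w j l‖ ≤ ‖g‖ := fun g w j l =>
    ((norm_le_pi_norm (g w j) l).trans (norm_le_pi_norm (g w) j)).trans (g.norm_coe_le_norm w)
  have hGle : ∀ (g : BoundedContinuousFunction ℂ (Fin m → Fin m → ℂ)) w j l,
      ‖(one + g w) j l‖ ≤ 1 + ‖g‖ := fun g w j l =>
    (norm_add_le _ _).trans (add_le_add (hone j l) (hentry g w j l))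
  have hGc : ∀ (g : BoundedContinuousFunction ℂ (Fin m → Fin m → ℂ)),
      Continuous fun w => one + g w := fun g => continuous_const.add g.continuous
  -- Φ(g) = T(-(1 + g)B), on bounded continuous functions on the whole plane; the norm is the
  -- supremum over all points and entries.
  let Φ : BoundedContinuousFunction ℂ (Fin m → Fin m → ℂ) →
      BoundedContinuousFunction ℂ (Fin m → Fin m → ℂ) := fun g =>
    BoundedContinuousFunction.ofNormedAddCommGroup
      (fun z j k => cauchyTransform (D (fun w => one + g w) j k) z)
      (continuous_pi fun j => continuous_pi fun k =>
        hTc _ (1 + ‖g‖) (by positivity) (hGc g) (hGle g) j k)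
      (κ * (1 + ‖g‖))
      (fun z => (pi_norm_le_iff_of_nonneg (by positivity)).2 fun j =>
        (pi_norm_le_iff_of_nonneg (by positivity)).2 fun k =>
          hTle _ (1 + ‖g‖) (by positivity) (hGc g) (hGle g) j k z)
  have hΦ : ∀ g z j k, Φ g z j k = cauchyTransform (D (fun w => one + g w) j k) z :=
    fun _ _ _ _ => rfl
  have hΦle : ∀ g, ‖Φ g‖ ≤ κ * (1 + ‖g‖) := fun g =>
    BoundedContinuousFunction.norm_ofNormedAddCommGroup_le _ (by positivity) _
  have hcontr : ContractingWith (1 / 2) Φ := by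
    refine ⟨NNReal.half_lt_self one_ne_zero,
      LipschitzWith.of_dist_le_mul fun g₁ g₂ => ?_⟩
    rw [BoundedContinuousFunction.dist_le (by positivity)]
    intro z
    rw [dist_eq_norm, dist_eq_norm]
    have hb : (0 : ℝ) ≤ ((1 / 2 : ℝ≥0) : ℝ) * ‖g₁ - g₂‖ := by positivity
    refine (pi_norm_le_iff_of_nonneg hb).2 fun j => (pi_norm_le_iff_of_nonneg hb).2 fun k => ?_
    rw [Pi.sub_apply, Pi.sub_apply, hΦ, hΦ, cauchyTransform_sub hp
      (hDmem _ _ (by positivity) (hGc g₁) (hGle g₁) j k).1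
      (hDmem _ _ (by positivity) (hGc g₂) (hGle g₂) j k).1 hδ (hD0 _ j k) (hD0 _ j k)]
    have heq : (fun w => D (fun w => one + g₁ w) j k w - D (fun w => one + g₂ w) j k w) =
        D (fun w => (g₁ - g₂) w) j k := by
      ext w
      simp only [hD, neg_sub_neg, ← Finset.sum_sub_distrib]
      rw [← Finset.sum_neg_distrib]
      refine Finset.sum_congr rfl fun l _ => ?_
      simp only [Pi.add_apply, BoundedContinuousFunction.coe_sub, Pi.sub_apply]
      ring
    rw [heq]
    refine (hTle _ ‖g₁ - g₂‖ (norm_nonneg _) (g₁ - g₂).continuous (hentry _) j k z).trans ?_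
    refine mul_le_mul_of_nonneg_right ?_ (norm_nonneg _)
    refine hκ2.trans ?_
    push_cast
    norm_num
  set g := ContractingWith.fixedPoint Φ hcontr with hg
  have hfix : Φ g = g := hcontr.fixedPoint_isFixedPt
  -- From ‖g‖ ≤ κ(1 + ‖g‖) and κ ≤ 1/4.
  have hgn : ‖g‖ ≤ 2 * κ := by
    have := hΦle g
    rw [hfix] at this
    nlinarith [norm_nonneg g]
  refine ⟨fun w => Matrix.of (g w), fun w => ?_, fun w j k => ?_, fun j k => ?_⟩
  · refine isUnit_one_add_of_norm_le (η := 2 * κ) (fun j k => (hentry g w j k).trans hgn) ?_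
    nlinarith
  · refine (hentry g w j k).trans (hgn.trans ?_)
    rw [hκ]
    have : 0 ≤ C * M * s := by positivity
    nlinarith
  · refine ⟨D (fun w => one + g w) j k, (hDmem _ _ (by positivity) (hGc g) (hGle g) j k).1,
      hD0 _ j k, fun w => rfl, fun w => ?_⟩
    have := hΦ g w j k
    rw [hfix] at this
    exact this

/-! ### Holomorphy of the gauged solution. -/

lemma isOpen_offZeros {m : ℕ} {Ω : Set ℂ} (hΩ : IsOpen Ω) {f : ℂ → Fin m → ℂ}
    (hf : ContinuousOn f Ω) : IsOpen (offZeros Ω f) :=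
  hf.isOpen_inter_preimage hΩ isOpen_compl_singleton

lemma MeasureTheory.LocallyIntegrableOn.eval_pi {m : ℕ} {u : ℂ → Fin m → ℂ} {U : Set ℂ}
    (hu : LocallyIntegrableOn u U) (k : Fin m) : LocallyIntegrableOn (fun z => u z k) U := by
  intro z hz
  obtain ⟨s, hs, hi⟩ := hu z hz
  exact ⟨s, hs, hi.eval k⟩

lemma setIntegral_mul_test {U : Set ℂ} {u φ : ℂ → ℂ} (hφU : tsupport φ ⊆ U) :
    ∫ z in U, u z * φ z = ∫ z, u z * φ z :=
  setIntegral_eq_integral_of_forall_compl_eq_zero fun z hz => by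
    rw [image_eq_zero_of_notMem_tsupport fun h => hz (hφU h), mul_zero]

lemma DbarEqOn.integral_eq {m : ℕ} {u h : ℂ → Fin m → ℂ} {U : Set ℂ} (H : DbarEqOn u h U)
    {φ : ℂ → ℂ} (hφ : ContDiff ℝ ∞ φ) (hcφ : HasCompactSupport φ) (hφU : tsupport φ ⊆ U)
    (k : Fin m) : ∫ z, u z k * dzbar φ z = -∫ z, h z k * φ z := by
  rw [← setIntegral_mul_test hφU, ← setIntegral_mul_test ((tsupport_dzbar_subset φ).trans hφU)]
  exact H.2.2 φ hφ hcφ hφU k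

/-- The gauge transformation makes a solution of `∂f/∂z̄ = A f` holomorphic. -/
lemma differentiableOn_gauge_mulVec {m : ℕ} {p : ℝ≥0∞} (hp : 2 < p) {Ω : Set ℂ}
    {f : ℂ → Fin m → ℂ} {A B g : ℂ → Matrix (Fin m) (Fin m) ℂ} (hΩ : IsOpen Ω)
    (hf : ContinuousOn f Ω) (hA : DbarEqOn f (fun z => A z *ᵥ f z) (offZeros Ω f))
    {z₀ : ℂ} {δ : ℝ} (hδ : 0 < δ) (hBA : ∀ w ∈ offZeros Ω f ∩ Metric.ball z₀ δ, B w = A w)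
    (hg : ∀ j k, ∃ b : ℂ → ℂ, MemLp b p volume ∧ (∀ w ∉ Metric.ball z₀ δ, b w = 0) ∧
      (∀ w, b w = -∑ l, (1 + g w) j l * B w l k) ∧ ∀ w, g w j k = cauchyTransform b w) :
    DifferentiableOn ℂ (fun w => (1 + g w) *ᵥ f w) (Metric.ball z₀ δ ∩ Ω) := by
  obtain ⟨q, hq, hqt, hqp⟩ := exists_finite_exponent hp
  choose b hbp hb0 hbe hgb using hg
  have hbq : ∀ j k, MemLp (b j k) q volume := fun j k =>
    (hbp j k).of_le_exponent_of_ball hqp (hb0 j k)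
  have hgc : ∀ j k, Continuous fun w => g w j k := by
    intro j k
    simp only [hgb j k]
    exact continuous_cauchyTransform hq hqt (hbq j k) hδ (hb0 j k)
  have hfk : ∀ k, ContinuousOn (fun w => f w k) Ω := fun k =>
    (continuous_apply k).comp_continuousOn hf
  set F : ℂ → Fin m → ℂ := fun w => (1 + g w) *ᵥ f w with hF
  have hFj : ∀ w j, F w j = ∑ k, (1 + g w) j k * f w k := fun w j => rfl
  have hFc : ∀ j, ContinuousOn (fun w => F w j) Ω := by
    intro j
    simp only [hFj, Matrix.add_apply]
    refine continuousOn_finsetSum _ fun k _ => ?_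
    exact (continuousOn_const.add (hgc j k).continuousOn).mul (hfk k)
  have hFz : ∀ w, F w ≠ 0 → f w ≠ 0 := by
    intro w hFw hfw
    exact hFw (by simp only [hF, hfw, Matrix.mulVec_zero])
  set V := offZeros Ω f ∩ Metric.ball z₀ δ with hV
  have hVo : IsOpen V := (isOpen_offZeros hΩ hf).inter Metric.isOpen_ball
  have hVΩ : V ⊆ Ω := fun w hw => hw.1.1
  have hVoff : V ⊆ offZeros Ω f := inter_subset_left
  have hhol : ∀ j, DifferentiableOn ℂ (fun w => F w j) V := by
    intro j
    -- By the product rule the weak derivative of F_j is the sum over k of b_jk f_k + (1 + g)_jk (A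
    -- f)_k. It vanishes because b = -(1 + g)B and B = A on V.
    refine differentiableOn_of_weak_dzbar_eq_zero hVo ((hFc j).mono hVΩ) fun φ hφ hcφ hφV => ?_
    have hprod : ∀ k, _ := fun k => weak_dzbar_mul_cauchyTransform hVo ((hfk k).mono hVΩ)
      ((hA.2.1.eval_pi k).mono_set hVoff)
      (fun ψ hψ hcψ hψV => hA.integral_eq hψ hcψ (hψV.trans hVoff) k) hq hqt (hbq j k) hδ
      (hb0 j k) ((1 : Matrix (Fin m) (Fin m) ℂ) j k) hφ hcφ hφV
    have e1 : ∀ z, F z j * dzbar φ z = ∑ k, f z k * dzbar φ z *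
        ((1 : Matrix (Fin m) (Fin m) ℂ) j k + cauchyTransform (b j k) z) := by
      intro z
      rw [hFj, Finset.sum_mul]
      refine Finset.sum_congr rfl fun k _ => ?_
      rw [Matrix.add_apply, hgb]
      ring
    simp only [e1]
    rw [integral_finsetSum _ fun k _ => (hprod k).1]
    have e2 : ∀ k, ∫ z, f z k * dzbar φ z *
        ((1 : Matrix (Fin m) (Fin m) ℂ) j k + cauchyTransform (b j k) z) =
        -∫ z, (b j k z * (f z k * φ z) + (A z *ᵥ f z) k * φ z *
          ((1 : Matrix (Fin m) (Fin m) ℂ) j k + cauchyTransform (b j k) z)) := by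
      intro k
      rw [(hprod k).2.2.2, integral_add (hprod k).2.1 (hprod k).2.2.1]
      ring
    simp only [e2]
    have e5 := integral_finsetSum Finset.univ fun k (_ : k ∈ Finset.univ) =>
      (hprod k).2.1.add (hprod k).2.2.1
    rw [Finset.sum_neg_distrib, neg_eq_zero]
    refine e5.symm.trans ?_
    simp only [Pi.add_apply]
    refine integral_eq_zero_of_ae (Eventually.of_forall fun z => ?_)
    rw [Pi.zero_apply]
    by_cases hz : z ∈ V
    swap
    · have : φ z = 0 := image_eq_zero_of_notMem_tsupport fun h => hz (hφV h)
      simp [this]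
    have e3 : ∑ k, b j k z * f z k = -∑ k, (1 + g z) j k * (A z *ᵥ f z) k := by
      simp only [hbe, hBA z hz, neg_mul, Finset.sum_neg_distrib, Matrix.mulVec, dotProduct,
        Finset.sum_mul, Finset.mul_sum]
      rw [Finset.sum_comm]
      simp only [mul_assoc]
    have e4 : ∀ k, b j k z * (f z k * φ z) + (A z *ᵥ f z) k * φ z *
        ((1 : Matrix (Fin m) (Fin m) ℂ) j k + cauchyTransform (b j k) z) =
        (b j k z * f z k + (1 + g z) j k * (A z *ᵥ f z) k) * φ z := by
      intro k
      rw [Matrix.add_apply, hgb]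
      ring
    simp only [e4]
    rw [← Finset.sum_mul, Finset.sum_add_distrib, e3, neg_add_cancel, zero_mul]
  rw [differentiableOn_pi]
  intro j
  -- Where F_j ≠ 0 also f ≠ 0, so F_j is already holomorphic off its own zeros, as Radó's theorem
  -- requires.
  refine rado (Metric.isOpen_ball.inter hΩ) ((hFc j).mono inter_subset_right)
    ((hhol j).mono ?_)
  rintro w ⟨⟨hwb, hwΩ⟩, hw⟩
  refine ⟨⟨hwΩ, hFz w fun h => hw ?_⟩, hwb⟩
  simp [h]

/-- Local gauge transformations, with the exponent `1 - 2/p` also for `p = ∞`. -/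
lemma exists_local_gauge (m : ℕ) {p : ℝ≥0∞} (hp : 2 < p) :
    ∃ ε c : ℝ, 0 < ε ∧ 0 < c ∧
      ∀ (Ω : Set ℂ) (f : ℂ → Fin m → ℂ) (A : ℂ → Matrix (Fin m) (Fin m) ℂ) (M : ℝ≥0),
      IsOpen Ω → ContinuousOn f Ω →
      (∀ j k, MemLp (fun z => A z j k) p (volume.restrict (offZeros Ω f))) →
      (∀ j k, eLpNorm (fun z => A z j k) p (volume.restrict (offZeros Ω f)) ≤ M) →
      DbarEqOn f (fun z => A z *ᵥ f z) (offZeros Ω f) →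
      ∀ δ : ℝ, 0 < δ → M * δ ^ (1 - 2 / p.toReal) < ε → ∀ z : ℂ,
        ∃ g : ℂ → Matrix (Fin m) (Fin m) ℂ, (∀ w, IsUnit (1 + g w)) ∧
          DifferentiableOn ℂ (fun w => (1 + g w) *ᵥ f w) (Metric.ball z δ ∩ Ω) ∧
          (∀ q : ℝ≥0∞, 2 < q → q ≠ ⊤ → q ≤ p → ∀ j k, ∃ C : ℝ≥0,
            HolderWith C (1 - 2 / q.toReal).toNNReal fun w => g w j k) ∧
          ∀ w j k, ‖g w j k‖ ≤ c * M * δ ^ (1 - 2 / p.toReal) := by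
  obtain ⟨ε, c, hε, hc, H⟩ := exists_gauge m hp
  refine ⟨ε, c, hε, hc, fun Ω f A M hΩ hf hA hAM hdbar δ hδ hsmall z => ?_⟩
  -- Cutting A off to S gives a coefficient in L^p of the plane, supported in the disc and still
  -- bounded by M. The disc need not lie in Ω.
  set S := offZeros Ω f ∩ Metric.ball z δ with hS
  have hoff := isOpen_offZeros hΩ hf
  have hSm : MeasurableSet S := (hoff.inter Metric.isOpen_ball).measurableSet
  have hle : (volume : Measure ℂ).restrict S ≤ volume.restrict (offZeros Ω f) :=
    Measure.restrict_mono_set _ inter_subset_left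
  have hind : ∀ j k, (fun w => S.indicator A w j k) = S.indicator fun w => A w j k := by
    intro j k
    ext w
    by_cases hw : w ∈ S <;> simp [hw]
  have hB : ∀ j k, MemLp (fun w => S.indicator A w j k) p volume := by
    intro j k
    rw [hind, memLp_indicator_iff_restrict hSm]
    exact (hA j k).mono_measure hle
  have hBM : ∀ j k, eLpNorm (fun w => S.indicator A w j k) p volume ≤ ENNReal.ofReal M := by
    intro j k
    rw [hind, eLpNorm_indicator_eq_eLpNorm_restrict hSm, ENNReal.ofReal_coe_nnreal]
    exact (eLpNorm_mono_measure _ hle).trans (hAM j k)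
  obtain ⟨g, hunit, hgle, hg⟩ := H z δ M (S.indicator A) hδ M.2 hB hBM
    (fun w hw => indicator_of_notMem (fun h => hw h.2) A) hsmall
  refine ⟨g, hunit, differentiableOn_gauge_mulVec hp hΩ hf hdbar hδ
    (fun w hw => indicator_of_mem hw A) hg, fun q hq hqt hqp j k => ?_, hgle⟩
  obtain ⟨b, hb, hb0, -, hgb⟩ := hg j k
  simp only [hgb]
  exact holderWith_cauchyTransform hq hqt (hb.of_le_exponent_of_ball hqp hb0) hδ hb0

/-! ### Isolated zeros. -/

/-- A locally invertible change of frame to a holomorphic function forces zeros to be isolated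
or to fill a neighbourhood. -/
lemma eventually_eq_zero_or_ne_zero_of_mulVec {m : ℕ} {f : ℂ → Fin m → ℂ}
    {G : ℂ → Matrix (Fin m) (Fin m) ℂ} {U : Set ℂ} (hU : IsOpen U) (hG : ∀ w, IsUnit (G w))
    (hd : DifferentiableOn ℂ (fun w => G w *ᵥ f w) U) {z : ℂ} (hz : z ∈ U) :
    (∀ᶠ w in 𝓝 z, f w = 0) ∨ ∀ᶠ w in 𝓝[≠] z, f w ≠ 0 := by
  have hana : ∀ j, AnalyticAt ℂ (fun w => (G w *ᵥ f w) j) z := fun j =>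
    (differentiableOn_pi.1 hd j).analyticAt (hU.mem_nhds hz)
  by_cases h : ∀ j, ∀ᶠ w in 𝓝 z, (G w *ᵥ f w) j = 0
  · left
    filter_upwards [eventually_all.2 h] with w hw
    refine Matrix.mulVec_injective_of_isUnit (hG w) ?_
    rw [Matrix.mulVec_zero]
    exact funext hw
  · right
    push Not at h
    obtain ⟨j, hj⟩ := h
    rcases (hana j).eventually_eq_zero_or_eventually_ne_zero with h0 | h0
    · exact absurd h0 (by simpa [Filter.not_eventually] using hj)
    · filter_upwards [h0] with w hw hfw
      exact hw (by simp [hfw])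

/-- On a connected set, the zeros are isolated unless the function vanishes identically. -/
lemma eventually_ne_zero_of_isPreconnected {m : ℕ} {f : ℂ → Fin m → ℂ} {Ω : Set ℂ}
    (hΩ : IsPreconnected Ω)
    (h : ∀ z ∈ Ω, (∀ᶠ w in 𝓝 z, f w = 0) ∨ ∀ᶠ w in 𝓝[≠] z, f w ≠ 0)
    (hne : ∃ z ∈ Ω, f z ≠ 0) : ∀ z ∈ Ω, ∀ᶠ w in 𝓝[≠] z, f w ≠ 0 := by
  intro z hz
  by_contra hcon
  have hz0 := (h z hz).resolve_right hcon
  have hopen : IsOpen {z | ∀ᶠ w in 𝓝 z, f w = 0} := isOpen_setOfPred_eventually_nhds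
  have hsub : Ω ⊆ {z | ∀ᶠ w in 𝓝 z, f w = 0} := by
    refine hΩ.subset_of_closure_inter_subset hopen ⟨z, hz, hz0⟩ ?_
    rintro x ⟨hx, hxΩ⟩
    rcases h x hxΩ with h0 | h0
    · exact h0
    rw [eventually_nhdsWithin_iff] at h0
    obtain ⟨y, hy, hyS⟩ := mem_closure_iff_nhds.1 hx _ h0
    by_cases hyx : y = x
    · rwa [hyx] at hyS
    · exact absurd (Eventually.self_of_nhds hyS) (hy hyx)
  obtain ⟨a, ha, hfa⟩ := hne
  have ha0 : ∀ᶠ w in 𝓝 a, f w = 0 := hsub ha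
  exact hfa ha0.self_of_nhds

/-! ### Removability of isolated points. -/

/-- An integrable function times cutoffs shrinking to a point has integral tending to zero. -/
lemma tendsto_integral_mul_shrinking {w X : ℂ → ℂ} (hw : Integrable w) (hX : Continuous X)
    (hXb : ∀ z, ‖X z‖ ≤ 1) {R : ℝ} (hX0 : ∀ z, R ≤ ‖z‖ → X z = 0) (a : ℂ) :
    Tendsto (fun n : ℕ => ∫ z, w z * X (((n : ℝ) + 1) • (z - a))) atTop (𝓝 0) := by
  have : Tendsto (fun n : ℕ => ∫ z, w z * X (((n : ℝ) + 1) • (z - a))) atTop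
      (𝓝 (∫ _ : ℂ, (0 : ℂ))) := by
    refine tendsto_integral_of_dominated_convergence (fun z => ‖w z‖) (fun n => ?_) hw.norm
      (fun n => Eventually.of_forall fun z => ?_) ?_
    · exact hw.1.mul (hX.comp (by fun_prop)).aestronglyMeasurable
    · rw [norm_mul]
      exact mul_le_of_le_one_right (norm_nonneg _) (hXb _)
    · have hae : ∀ᵐ z : ℂ, z ≠ a := by simp [ae_iff]
      filter_upwards [hae] with z hz
      refine tendsto_const_nhds.congr' ?_
      obtain ⟨N, hN⟩ := exists_nat_gt (R / ‖z - a‖)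
      have hza : 0 < ‖z - a‖ := norm_pos_iff.2 (sub_ne_zero.2 hz)
      filter_upwards [eventually_ge_atTop N] with n hn
      rw [hX0, mul_zero]
      rw [norm_smul, Real.norm_of_nonneg (by positivity), ← div_le_iff₀ hza]
      have : (N : ℝ) ≤ n := by exact_mod_cast hn
      linarith
  simpa using this

lemma dzbar_comp_smul_sub {X : ℂ → ℂ} (hX : Differentiable ℝ X) (t : ℝ) (a z : ℂ) :
    dzbar (fun w => X (t • (w - a))) z = t * dzbar X (t • (z - a)) := by
  have h1 : HasFDerivAt (fun w : ℂ => t • (w - a)) (t • ContinuousLinearMap.id ℝ ℂ) z :=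
    ((hasFDerivAt_id z).sub_const a).const_smul t
  have h2 := ((hX (t • (z - a))).hasFDerivAt.comp z h1).fderiv
  have h3 : ∀ v : ℂ, fderiv ℝ (fun w => X (t • (w - a))) z v =
      t * fderiv ℝ X (t • (z - a)) v := by
    intro v
    change fderiv ℝ (X ∘ fun w => t • (w - a)) z v = _
    rw [h2]
    simp
  rw [dzbar, dzbar, h3, h3]
  ring

/-- Removable singularities for the weak equation `∂u/∂z̄ = h`, with `u` continuous: the equation
extends across a set that meets the support of the test function in finitely many points. -/
lemma weak_dzbar_of_finite_inter {Ω Z : Set ℂ} (hΩ : IsOpen Ω) {u h : ℂ → ℂ}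
    (hu : ContinuousOn u Ω) (hh : LocallyIntegrableOn h Ω)
    (hw : ∀ ψ : ℂ → ℂ, ContDiff ℝ ∞ ψ → HasCompactSupport ψ → tsupport ψ ⊆ Ω \ Z →
      ∫ z, u z * dzbar ψ z = -∫ z, h z * ψ z) :
    ∀ (n : ℕ) (φ : ℂ → ℂ), ContDiff ℝ ∞ φ → HasCompactSupport φ → tsupport φ ⊆ Ω →
      (tsupport φ ∩ Z).Finite → (tsupport φ ∩ Z).ncard = n →
      ∫ z, u z * dzbar φ z = -∫ z, h z * φ z := by
  intro n
  -- Cutoffs χ_n shrinking to one point a of the finite set split φ into (1 - χ_n)φ, whose support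
  -- omits a so that the induction hypothesis applies, and χ_nφ, whose contribution tends to 0.
  induction n using Nat.strong_induction_on with
  | _ n ih =>
  intro φ hφ hcφ hφΩ hfin hcard
  rcases (tsupport φ ∩ Z).eq_empty_or_nonempty with hemp | ⟨a, haφ, haZ⟩
  · refine hw φ hφ hcφ fun z hz => ⟨hφΩ hz, fun hzZ => ?_⟩
    have : z ∈ tsupport φ ∩ Z := ⟨hz, hzZ⟩
    rw [hemp] at this
    exact this
  have hul : LocallyIntegrableOn u Ω := hu.locallyIntegrableOn hΩ.measurableSet
  have hint : ∀ ψ : ℂ → ℂ, ContDiff ℝ ∞ ψ → HasCompactSupport ψ → tsupport ψ ⊆ Ω →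
      Integrable (fun z => u z * dzbar ψ z) ∧ Integrable (fun z => h z * ψ z) :=
    fun ψ hψ hcψ hψΩ =>
      ⟨integrable_mul_of_tsupport_subset hul (continuous_dzbar hψ) (hasCompactSupport_dzbar hcψ)
        ((tsupport_dzbar_subset ψ).trans hψΩ),
      integrable_mul_of_tsupport_subset hh hψ.continuous hcψ hψΩ⟩
  obtain ⟨hi1, hi2⟩ := hint φ hφ hcφ hφΩ
  let ρ : ContDiffBump (0 : ℂ) := ⟨1, 2, one_pos, one_lt_two⟩
  set X : ℂ → ℂ := fun z => (ρ z : ℂ) with hX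
  have hXs : ContDiff ℝ ∞ X := Complex.ofRealCLM.contDiff.comp ρ.contDiff
  have hXc : HasCompactSupport X := ρ.hasCompactSupport.comp_left Complex.ofReal_zero
  have hXb : ∀ z, ‖X z‖ ≤ 1 := fun z => by
    rw [hX, Complex.norm_real, Real.norm_of_nonneg ρ.nonneg]
    exact ρ.le_one
  have hX0 : ∀ z : ℂ, 2 ≤ ‖z‖ → X z = 0 := fun z hz => by
    have : ρ z = 0 := ρ.zero_of_le_dist (by simpa using hz)
    simp [hX, this]
  have hX1 : ∀ z : ℂ, ‖z‖ ≤ 1 → X z = 1 := fun z hz => by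
    have : ρ z = 1 := ρ.one_of_mem_closedBall (by simpa using hz)
    simp [hX, this]
  have huφ : Continuous (fun z => u z * φ z) :=
    (hu.mul hφ.continuous.continuousOn).continuous_of_tsupport_subset hΩ
      ((tsupport_mul_subset_right).trans hφΩ)
  obtain ⟨K, hK⟩ := (hcφ.mul_left (f := u)).exists_bound_of_continuous huφ
  -- the cutoffs around `a`
  set χ : ℕ → ℂ → ℂ := fun n z => X (((n : ℝ) + 1) • (z - a)) with hχ
  have hχs : ∀ n, ContDiff ℝ ∞ (χ n) := fun n =>
    hXs.comp ((contDiff_id.sub contDiff_const).const_smul _)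
  have hone : ∀ n : ℕ, (∫ z, u z * dzbar φ z) + ∫ z, h z * φ z =
      (∫ z, u z * φ z * dzbar (χ n) z) + (∫ z, u z * dzbar φ z * χ n z) +
        ∫ z, h z * φ z * χ n z := by
    intro n
    set φ₁ : ℂ → ℂ := fun z => (1 - χ n z) * φ z with hφ₁
    set φ₂ : ℂ → ℂ := fun z => χ n z * φ z with hφ₂
    have h1s : ContDiff ℝ ∞ φ₁ := (contDiff_const.sub (hχs n)).mul hφ
    have h2s : ContDiff ℝ ∞ φ₂ := (hχs n).mul hφ
    have h1t : tsupport φ₁ ⊆ tsupport φ := tsupport_mul_subset_right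
    have h2t : tsupport φ₂ ⊆ tsupport φ := tsupport_mul_subset_right
    have h1c : HasCompactSupport φ₁ := hcφ.mul_left
    have h2c : HasCompactSupport φ₂ := hcφ.mul_left
    have ha1 : a ∉ tsupport φ₁ := by
      rw [notMem_tsupport_iff_eventuallyEq]
      filter_upwards [Metric.ball_mem_nhds a (show (0 : ℝ) < 1 / ((n : ℝ) + 1) by positivity)]
        with z hz
      have : χ n z = 1 := by
        refine hX1 _ ?_
        rw [norm_smul, Real.norm_of_nonneg (by positivity), mul_comm, ← le_div_iff₀ (by positivity),
          ← dist_eq_norm]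
        exact le_of_lt hz
      simp [hφ₁, this]
    have hss : tsupport φ₁ ∩ Z ⊂ tsupport φ ∩ Z := by
      refine ⟨inter_subset_inter_left _ h1t, fun hle => ha1 (hle ⟨haφ, haZ⟩).1⟩
    have hL1 := ih _ (hcard ▸ ncard_lt_ncard hss hfin) φ₁ h1s h1c (h1t.trans hφΩ)
      (hfin.subset hss.1) rfl
    obtain ⟨i1, i2⟩ := hint φ₁ h1s h1c (h1t.trans hφΩ)
    obtain ⟨j1, j2⟩ := hint φ₂ h2s h2c (h2t.trans hφΩ)
    have hd2 : ∀ z, dzbar φ₂ z = dzbar (χ n) z * φ z + χ n z * dzbar φ z := fun z =>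
      dzbar_mul ((hχs n).differentiable (by simp) z) (hφ.differentiable (by simp) z)
    have hsum : φ = fun z => φ₁ z + φ₂ z := by
      ext z
      simp only [hφ₁, hφ₂]
      ring
    have hdsum : ∀ z, dzbar φ z = dzbar φ₁ z + dzbar φ₂ z := by
      intro z
      conv_lhs => rw [hsum]
      have := fderiv_fun_add (h1s.differentiable (by simp) z) (h2s.differentiable (by simp) z)
      simp only [dzbar, this, add_apply]
      ring
    have hA : ∫ z, u z * dzbar φ z = (∫ z, u z * dzbar φ₁ z) + ∫ z, u z * dzbar φ₂ z := by
      rw [← integral_add i1 j1]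
      simp only [hdsum, mul_add]
    have hB : ∫ z, h z * φ z = (∫ z, h z * φ₁ z) + ∫ z, h z * φ₂ z := by
      rw [← integral_add i2 j2]
      congr 1
      ext z
      rw [← mul_add]
      congr 1
      exact congrFun hsum z
    have k2 : Integrable (fun z => u z * dzbar φ z * χ n z) :=
      hi1.mul_bdd (c := 1) (hχs n).continuous.aestronglyMeasurable
        (Eventually.of_forall fun z => hXb _)
    have k1 : Integrable (fun z => u z * φ z * dzbar (χ n) z) := by
      refine (j1.sub k2).congr (Eventually.of_forall fun z => ?_)
      simp only [Pi.sub_apply, hd2]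
      ring
    have hC : ∫ z, u z * dzbar φ₂ z =
        (∫ z, u z * φ z * dzbar (χ n) z) + ∫ z, u z * dzbar φ z * χ n z := by
      rw [← integral_add k1 k2]
      congr 1
      ext z
      rw [hd2]
      ring
    have hD : ∫ z, h z * φ₂ z = ∫ z, h z * φ z * χ n z := by
      congr 1
      ext z
      simp only [hφ₂]
      ring
    rw [hA, hB, ← hC, ← hD]
    linear_combination hL1
  have t2 := tendsto_integral_mul_shrinking hi1 hXs.continuous hXb hX0 a
  have t3 := tendsto_integral_mul_shrinking hi2 hXs.continuous hXb hX0 a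
  -- The derivative of χ_n has size O(n) but is supported on area O(n^(-2)), so its L¹ norm is
  -- O(1/n). Continuity of u enters through the boundedness of uφ.
  have t1 : Tendsto (fun n => ∫ z, u z * φ z * dzbar (χ n) z) atTop (𝓝 0) := by
    have hdX : Integrable (fun z => ‖dzbar X z‖) :=
      ((continuous_dzbar hXs).integrable_of_hasCompactSupport (hasCompactSupport_dzbar hXc)).norm
    have hle : ∀ n : ℕ, ‖∫ z, u z * φ z * dzbar (χ n) z‖ ≤
        (K * ∫ z, ‖dzbar X z‖) * (1 / ((n : ℝ) + 1)) := by
      intro n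
      have ht : (0 : ℝ) < (n : ℝ) + 1 := by positivity
      have hscale : ∫ z, ‖dzbar X (((n : ℝ) + 1) • (z - a))‖ =
          (((n : ℝ) + 1) ^ 2)⁻¹ * ∫ z, ‖dzbar X z‖ := by
        rw [integral_sub_right_eq_self (fun z => ‖dzbar X (((n : ℝ) + 1) • z)‖) a,
          Measure.integral_comp_smul_of_nonneg volume (fun z => ‖dzbar X z‖) _ (hR := ht.le)]
        simp
      have hi : Integrable (fun z => ‖dzbar X (((n : ℝ) + 1) • (z - a))‖) :=
        (hdX.comp_smul ht.ne').comp_sub_right a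
      refine (norm_integral_le_of_norm_le ((hi.const_mul ((n : ℝ) + 1)).const_mul K)
        (Eventually.of_forall fun z => ?_)).trans (le_of_eq ?_)
      · rw [hχ, dzbar_comp_smul_sub (hXs.differentiable (by simp)), norm_mul,
          norm_mul (_ : ℂ) (dzbar X _), Complex.norm_real, Real.norm_of_nonneg ht.le]
        exact mul_le_mul_of_nonneg_right (hK z) (by positivity)
      · rw [integral_const_mul, integral_const_mul, hscale]
        field_simp
    refine squeeze_zero_norm hle ?_
    simpa using tendsto_one_div_add_atTop_nhds_zero_nat.const_mul (K * ∫ z, ‖dzbar X z‖)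
  have hlim := (t1.add t2).add t3
  have hconst : Tendsto (fun _ : ℕ => (∫ z, u z * dzbar φ z) + ∫ z, h z * φ z) atTop
      (𝓝 (0 + 0 + 0)) := hlim.congr fun n => (hone n).symm
  have := tendsto_nhds_unique hconst tendsto_const_nhds
  linear_combination -this

/-! ### Assembly: small radii, the equation across the zeros, the theorem. -/

lemma tendsto_rpow_zero_of_two_lt {p : ℝ≥0∞} (hp : 2 < p) :
    Tendsto (fun δ : ℝ => δ ^ (1 - 2 / p.toReal)) (𝓝[>] 0) (𝓝 0) := by
  have hs : 0 < 1 - 2 / p.toReal := by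
    by_cases hpt : p = ⊤
    · simp [hpt]
    · have hp2 : 2 < p.toReal := by simpa using (ENNReal.toReal_lt_toReal (by simp) hpt).2 hp
      rw [sub_pos, div_lt_one (by linarith)]
      exact hp2
  have := (Real.continuousAt_rpow_const 0 (1 - 2 / p.toReal) (Or.inr hs.le)).tendsto
  rw [Real.zero_rpow hs.ne'] at this
  exact this.mono_left nhdsWithin_le_nhds

/-- For p = ∞ one has `p.toReal = 0`, so the exponent is 1 and δ is compared with δ(1 + |log δ|).
The sup bound on the gauge needs no logarithm, so passing to `phi` only weakens it. -/
lemma rpow_le_phi {p : ℝ≥0∞} {δ : ℝ} (hδ : 0 < δ) : δ ^ (1 - 2 / p.toReal) ≤ phi p δ := by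
  rw [phi]
  split_ifs with h
  · simp only [h, ENNReal.toReal_top, div_zero, sub_zero, Real.rpow_one]
    nlinarith [abs_nonneg (Real.log δ)]
  · exact le_rfl

/-- The zeros of a solution that does not vanish identically are isolated. -/
lemma eventually_ne_zero_of_dbarEqOn {m : ℕ} {p : ℝ≥0∞} (hp : 2 < p) {Ω : Set ℂ}
    {f : ℂ → Fin m → ℂ} {A : ℂ → Matrix (Fin m) (Fin m) ℂ} (hΩ : IsOpen Ω)
    (hΩc : IsPreconnected Ω) (hf : ContinuousOn f Ω)
    (hA : ∀ j k, MemLp (fun z => A z j k) p (volume.restrict (offZeros Ω f)))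
    (hdbar : DbarEqOn f (fun z => A z *ᵥ f z) (offZeros Ω f)) (hne : ∃ z ∈ Ω, f z ≠ 0) :
    ∀ z ∈ Ω, ∀ᶠ w in 𝓝[≠] z, f w ≠ 0 := by
  obtain ⟨ε, c, hε, -, H⟩ := exists_local_gauge m hp
  set M : ℝ≥0 := ∑ j, ∑ k,
    (eLpNorm (fun z => A z j k) p (volume.restrict (offZeros Ω f))).toNNReal with hM
  have hAM : ∀ j k, eLpNorm (fun z => A z j k) p (volume.restrict (offZeros Ω f)) ≤ M := by
    intro j k
    rw [← ENNReal.coe_toNNReal (hA j k).2.ne, ENNReal.coe_le_coe, hM]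
    exact (Finset.single_le_sum (f := fun k =>
      (eLpNorm (fun z => A z j k) p (volume.restrict (offZeros Ω f))).toNNReal)
      (fun _ _ => zero_le) (Finset.mem_univ k)).trans
      (Finset.single_le_sum (f := fun j => ∑ k,
        (eLpNorm (fun z => A z j k) p (volume.restrict (offZeros Ω f))).toNNReal)
        (fun _ _ => zero_le) (Finset.mem_univ j))
  have hlim : Tendsto (fun δ : ℝ => (M : ℝ) * δ ^ (1 - 2 / p.toReal)) (𝓝[>] 0) (𝓝 0) := by
    simpa using (tendsto_rpow_zero_of_two_lt hp).const_mul (M : ℝ)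
  obtain ⟨δ, hδε, hδ⟩ := ((hlim.eventually_lt_const hε).and self_mem_nhdsWithin).exists
  refine eventually_ne_zero_of_isPreconnected hΩc (fun z hz => ?_) hne
  obtain ⟨g, hunit, hd, -, -⟩ := H Ω f A M hΩ hf hA hAM hdbar δ hδ hδε z
  exact eventually_eq_zero_or_ne_zero_of_mulVec (Metric.isOpen_ball.inter hΩ) hunit hd
    ⟨Metric.mem_ball_self hδ, hz⟩

lemma locallyIntegrableOn_indicator_mulVec {m : ℕ} {p : ℝ≥0∞} (hp : 2 < p) {Ω : Set ℂ}
    {f : ℂ → Fin m → ℂ} {A : ℂ → Matrix (Fin m) (Fin m) ℂ} (hΩ : IsOpen Ω)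
    (hf : ContinuousOn f Ω)
    (hA : ∀ j k, MemLp (fun z => A z j k) p (volume.restrict (offZeros Ω f))) :
    LocallyIntegrableOn (fun z => (offZeros Ω f).indicator A z *ᵥ f z) Ω := by
  rw [locallyIntegrableOn_iff hΩ.isLocallyClosed]
  intro K hK hKc
  refine Integrable.of_eval fun j => ?_
  change Integrable (fun z => ∑ k, (offZeros Ω f).indicator A z j k * f z k) (volume.restrict K)
  refine integrable_finsetSum _ fun k _ => ?_
  have hind : (fun z => (offZeros Ω f).indicator A z j k) =
      (offZeros Ω f).indicator fun z => A z j k := by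
    ext w
    by_cases hw : w ∈ offZeros Ω f <;> simp [hw]
  have hmem : MemLp (fun z => (offZeros Ω f).indicator A z j k) p volume := by
    rw [hind, memLp_indicator_iff_restrict (isOpen_offZeros hΩ hf).measurableSet]
    exact hA j k
  exact ((hmem.locallyIntegrable (one_le_two.trans hp.le)).integrableOn_isCompact
    hKc).mul_continuousOn ((continuous_apply k).comp_continuousOn (hf.mono hK)) hKc

/-- The equation extends across the zero set. -/
lemma dbarEqOn_indicator {m : ℕ} {p : ℝ≥0∞} (hp : 2 < p) {Ω : Set ℂ}
    {f : ℂ → Fin m → ℂ} {A : ℂ → Matrix (Fin m) (Fin m) ℂ} (hΩ : IsOpen Ω)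
    (hΩc : IsPreconnected Ω) (hf : ContinuousOn f Ω)
    (hA : ∀ j k, MemLp (fun z => A z j k) p (volume.restrict (offZeros Ω f)))
    (hdbar : DbarEqOn f (fun z => A z *ᵥ f z) (offZeros Ω f)) :
    DbarEqOn f (fun z => (offZeros Ω f).indicator A z *ᵥ f z) Ω := by
  have hloc := locallyIntegrableOn_indicator_mulVec hp hΩ hf hA
  refine ⟨hf.locallyIntegrableOn hΩ.measurableSet, hloc, fun φ hφ hcφ hφΩ j => ?_⟩
  by_cases hne : ∃ z ∈ Ω, f z ≠ 0
  swap
  · push Not at hne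
    rw [setIntegral_eq_zero_of_forall_eq_zero, setIntegral_eq_zero_of_forall_eq_zero, neg_zero]
    · intro z hz
      simp [hne z hz]
    · intro z hz
      simp [hne z hz]
  have hiso := eventually_ne_zero_of_dbarEqOn hp hΩ hΩc hf hA hdbar hne
  -- Infinitely many zeros in the compact support would accumulate at a point of Ω.
  have hfin : (tsupport φ ∩ {z | f z = 0}).Finite := by
    by_contra hinf
    obtain ⟨x, hx, hacc⟩ := Set.Infinite.exists_accPt_of_subset_isCompact hinf hcφ
      inter_subset_left
    rw [accPt_iff_frequently_nhdsNE] at hacc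
    exact hacc ((hiso x (hφΩ hx)).mono fun w hw hm => hw hm.2)
  rw [setIntegral_mul_test hφΩ, setIntegral_mul_test ((tsupport_dzbar_subset φ).trans hφΩ)]
  refine weak_dzbar_of_finite_inter (Z := {z | f z = 0}) hΩ
    ((continuous_apply j).comp_continuousOn hf) (hloc.eval_pi j) (fun ψ hψ hcψ hψΩ => ?_) _ φ hφ
    hcφ hφΩ hfin rfl
  have hψoff : tsupport ψ ⊆ offZeros Ω f := hψΩ
  rw [Function.comp_def, hdbar.integral_eq hψ hcψ hψoff j]
  congr 2
  ext z
  by_cases hz : z ∈ offZeros Ω f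
  · rw [indicator_of_mem hz]
  · rw [image_eq_zero_of_notMem_tsupport fun h => hz (hψoff h), mul_zero, mul_zero]

theorem propositionC (m : ℕ) (p : ℝ≥0∞) (hp : 2 < p) :
    (∀ (Ω : Set ℂ) (f : ℂ → Fin m → ℂ) (A : ℂ → Matrix (Fin m) (Fin m) ℂ),
      IsOpen Ω → IsConnected Ω → ContinuousOn f Ω →
      (∀ j k, MemLp (fun z => A z j k) p (volume.restrict (offZeros Ω f))) →
      DbarEqOn f (fun z => A z *ᵥ f z) (offZeros Ω f) →
      (∃ z ∈ Ω, f z ≠ 0) →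
        (∀ z ∈ Ω, f z = 0 → ∀ᶠ w in 𝓝[≠] z, f w ≠ 0) ∧
        DbarEqOn f (fun z => (offZeros Ω f).indicator A z *ᵥ f z) Ω) ∧
    (∃ ε c : ℝ, 0 < ε ∧ 0 < c ∧
      ∀ (Ω : Set ℂ) (f : ℂ → Fin m → ℂ) (A : ℂ → Matrix (Fin m) (Fin m) ℂ) (M : ℝ≥0),
      IsOpen Ω → IsConnected Ω → ContinuousOn f Ω →
      (∀ j k, MemLp (fun z => A z j k) p (volume.restrict (offZeros Ω f))) →
      (∀ j k, eLpNorm (fun z => A z j k) p (volume.restrict (offZeros Ω f)) ≤ M) →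
      DbarEqOn f (fun z => A z *ᵥ f z) (offZeros Ω f) →
        (∀ δ : ℝ, 0 < δ → M * phi p δ < ε → ∀ z ∈ Ω,
          ∃ g : ℂ → Matrix (Fin m) (Fin m) ℂ,
            (∀ w ∈ Metric.ball z δ, IsUnit (1 + g w)) ∧
            DifferentiableOn ℂ (fun w => (1 + g w) *ᵥ f w) (Metric.ball z δ ∩ Ω) ∧
            (p ≠ ⊤ → MatrixHolderOn (1 - 2 / p.toReal).toNNReal g (Metric.ball z δ)) ∧
            (p = ⊤ → ∀ α : ℝ≥0, 0 < α → α < 1 → MatrixHolderOn α g (Metric.ball z δ)) ∧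
            (∀ w ∈ Metric.ball z δ, ∀ j k, ‖g w j k‖ ≤ c * M * phi p δ)) ∧
        DbarEqOn f (fun z => (offZeros Ω f).indicator A z *ᵥ f z) Ω) := by
  refine ⟨fun Ω f A hΩ hΩc hf hA hdbar hne => ⟨fun z hz _ =>
    eventually_ne_zero_of_dbarEqOn hp hΩ hΩc.isPreconnected hf hA hdbar hne z hz,
    dbarEqOn_indicator hp hΩ hΩc.isPreconnected hf hA hdbar⟩, ?_⟩
  obtain ⟨ε, c, hε, hc, H⟩ := exists_local_gauge m hp
  refine ⟨ε, c, hε, hc, fun Ω f A M hΩ hΩc hf hA hAM hdbar => ⟨fun δ hδ hsmall z _ => ?_,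
    dbarEqOn_indicator hp hΩ hΩc.isPreconnected hf hA hdbar⟩⟩
  have hle : δ ^ (1 - 2 / p.toReal) ≤ phi p δ := rpow_le_phi hδ
  obtain ⟨g, hunit, hd, hholder, hbound⟩ := H Ω f A M hΩ hf hA hAM hdbar δ hδ
    ((mul_le_mul_of_nonneg_left hle M.2).trans_lt hsmall) z
  refine ⟨g, fun w _ => hunit w, hd, fun hpt j k => ?_, fun hpt α hα0 hα1 j k => ?_,
    fun w _ j k => (hbound w j k).trans (mul_le_mul_of_nonneg_left hle (by positivity))⟩
  · obtain ⟨C, hC⟩ := hholder p hp hpt le_rfl j k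
    exact ⟨C, hC.holderOnWith _⟩
  · have hα1' : (0 : ℝ) < 1 - α := sub_pos.2 (by exact_mod_cast hα1)
    have hα0' : (0 : ℝ) < α := by exact_mod_cast hα0
    have hq : (2 : ℝ) < 2 / (1 - α) := by
      rw [lt_div_iff₀ hα1']
      linarith
    -- q = 2/(1 - α) is the finite exponent with 1 - 2/q = α.
    obtain ⟨C, hC⟩ := hholder (ENNReal.ofReal (2 / (1 - α)))
      (by simpa using (ENNReal.ofReal_lt_ofReal_iff (by linarith)).2 hq) ENNReal.ofReal_ne_top
      (hpt ▸ le_top) j k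
    have hexp : (1 - 2 / (ENNReal.ofReal (2 / (1 - α))).toReal).toNNReal = α := by
      rw [ENNReal.toReal_ofReal (by linarith), div_div_cancel₀ two_ne_zero, sub_sub_cancel,
        Real.toNNReal_coe]
    rw [hexp] at hC
    exact ⟨C, hC.holderOnWith _⟩
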